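/- **Setting.** Let $a<b$ be real, $d\ge 1$ an integer, $K,L\in(0,\infty)$, $p\in[2,\infty)$, $\varrho\in(0,1]$, and let $\|x\|=\sum_{k=1}^d|x_k|$ on $\mathbb R^d$, $B(x,r)=\{y:\|y-x\|\le r\}$, $B(x,\infty)=\mathbb R^d$. For $R\in[0,\infty]$ let $F^\varrho_R$ be the set of pairs $(\eta,f)$, $\eta\in\mathbb R^d$, $f:[a,b]\times\mathbb R^d\to\mathbb R^d$, such that $\|\eta\|\le K$; $f$ is continuous; $\|f(t,x)\|\le K(1+\|x\|)$ for all $t,x$; $\|f(t,x)-f(s,x)\|\le L|t-s|^\varrho$ for $t,s\in[a,b]$, $x\in B(\eta,R)$; and $\|f(t,x)-f(t,y)\|\le L\|x-y\|$ for $t\in[a,b]$, $x,y\in B(\eta,R)$. Put $R_0=\max\{R_1,R_2\}$ with $$R_1=(K+2)e^{(K+1)(b-a)}+K-1,\qquad R_2=K(1+b-a)e^{K(b-a)}+K.$$ For $(\eta,f)\in F^\varrho_{R_0}$ let $z(\eta,f)$ be the unique solution of $z'(t)=f(t,z(t))$ on $[a,b]$, $z(a)=\eta$. *Noise.* For $\delta\in[0,1]$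 let $\mathcal K_1(\delta)$ be the set of Borel maps $e:[a,b]\times\mathbb R^d\to\mathbb R^d$ with $\|e(t,y)\|\le\delta(1+\|y\|)$ for all $t,y$, and $\mathcal K_2(\delta)$ the set of those $e\in\mathcal K_1(\delta)$ with $\|e(t,x)-e(t,y)\|\le\delta\|x-y\|$ for all $t,x,y$. Put $V^m_{(\eta,f)}(\delta)=B(\eta,\delta)\times\{f+e: e\in\mathcal K_m(\delta)\}$, $m\in\{1,2\}$. *Algorithms.* Let $(\Omega,\Sigma,\mathbb P)$ be a probability space that carries, for every $k$, $k$ independent random variables uniformly distributed on $(0,1)$. An algorithm $\mathcal A$ is given by $i\in\{0,1,2,\dots\}$, points $t_0,\dots,t_{i-1}\in[a,b]$, a random vector $(\theta_0,\dots,\theta_{i-1}):\Omega\to[a,b]^i$, Borel maps $\psi_j:\mathbb R^{(2j+1)d}\to\mathbb R^d\times\mathbb R^d$ ($0\le j<i$), and a map $\varphi:\mathbb R^{(2i+1)d}\to D([a,b];\mathbb R^d)$ that is measurable for the Borel $\sigma$-field of the Skorokhod topology. For data $(\tilde\eta,\tilde f)$ its space points are $$(y_j,z_j)=\psi_j\bigl(\tilde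 f(t_0,y_0),\dots,\tilde f(t_{j-1},y_{j-1}),\tilde f(\theta_0,z_0),\dots,\tilde f(\theta_{j-1},z_{j-1}),\tilde\eta\bigr),$$ and its output is $\mathcal A(\tilde\eta,\tilde f)=\varphi\bigl(\tilde f(t_0,y_0),\dots,\tilde f(t_{i-1},y_{i-1}),\tilde f(\theta_0,z_0),\dots,\tilde f(\theta_{i-1},z_{i-1}),\tilde\eta\bigr)$. It uses $2i$ noisy evaluations. Let $\Phi_n$ be the set of algorithms with $2i\le n$. For $\mathcal G\subseteq F^\varrho_{R_0}$ and $m\in\{1,2\}$ the $n$th minimal error is $$e^{(p)}_n(\mathcal G,V^m,\delta)=\inf_{\mathcal A\in\Phi_n}\ \sup_{(\eta,f)\in\mathcal G}\ \sup_{(\tilde\eta,\tilde f)\in V^m_{(\eta,f)}(\delta)}\Bigl(\mathbb E\sup_{a\le t\le b}\|z(\eta,f)(t)-\mathcal A(\tilde\eta,\tilde f)(t)\|^p\Bigr)^{1/p}.$$ **Theorem.** There exist $C_1,C_2>0$, $n_0\in\mathbb N$ and $\delta_0\in(0,1]$, depending only on $a,b,d,K,L,p,\varrho$, such that for every such probability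 space, all integers $n\ge n_0$ and all $\delta\in[0,\delta_0]$, $$C_1\bigl(n^{-(\varrho+\frac12)}+\delta\bigr)\le e^{(p)}_n(F^\varrho_\infty,V^2,\delta)\le e^{(p)}_n(F^\varrho_{R_0},V^1,\delta)\le C_2\bigl(n^{-\min\{1,\varrho+\frac12\}}+\delta\bigr).$$ -/

import Mathlib

open Set Filter Topology MeasureTheory ProbabilityTheory
open scoped ENNReal

namespace InexactODE

/-- `ℝ^d` with the one norm `‖x‖ = ∑ |x_k|`. -/
abbrev Vec (d : ℕ) : Type := PiLp 1 (fun _ : Fin d => ℝ)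

/-- The domain `[a,b] × ℝ^d` of right-hand sides and of noise functions. -/
abbrev Dom (a b : ℝ) (d : ℕ) : Type := Icc a b × Vec d

/-- Initial value problems, given by pairs `(η, f)`. -/
abbrev Problem (a b : ℝ) (d : ℕ) : Type := Vec d × (Dom a b d → Vec d)

/-! ### The class of initial value problems and their solutions -/

/-- The class `F^ϱ_R(a,b,d,ϱ,K,L)`, where `R ∈ [0,∞]`; for `R = ∞` the ball is the whole space. -/
def problemClass (a b : ℝ) (d : ℕ) (ϱ K L : ℝ) (R : ℝ≥0∞) : Set (Problem a b d) :=
  {q | ‖q.1‖ ≤ K ∧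
    Continuous q.2 ∧
    (∀ (t : Icc a b) (x : Vec d), ‖q.2 (t, x)‖ ≤ K * (1 + ‖x‖)) ∧
    (∀ (t s : Icc a b) (x : Vec d), edist x q.1 ≤ R →
      ‖q.2 (t, x) - q.2 (s, x)‖ ≤ L * |(t : ℝ) - s| ^ ϱ) ∧
    (∀ (t : Icc a b) (x y : Vec d), edist x q.1 ≤ R → edist y q.1 ≤ R →
      ‖q.2 (t, x) - q.2 (t, y)‖ ≤ L * ‖x - y‖)}

/-- `z` solves `z'(t) = f(t, z(t))` on `[a,b]`, `z(a) = η` (one-sided derivatives at `a`, `b`).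
Only the values of `z` on `[a,b]` matter. -/
def IsSolution {a b : ℝ} {d : ℕ} (q : Problem a b d) (z : ℝ → Vec d) : Prop :=
  z a = q.1 ∧ ∀ t : Icc a b, HasDerivWithinAt z (q.2 (t, z t)) (Icc a b) t

/-- The solution `z(η,f)`. For problems in `F^ϱ_R` with `R ≥ K(1+b-a)e^{K(b-a)} + K` a solution
exists and its values on `[a,b]` are unique. -/
noncomputable def solution {a b : ℝ} {d : ℕ} (q : Problem a b d) : ℝ → Vec d :=
  Classical.epsilon (IsSolution q)

/-! ### Inexact information -/

/-- The noise class `𝒦₁(δ)`. -/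
def noise₁ (a b : ℝ) (d : ℕ) (δ : ℝ) : Set (Dom a b d → Vec d) :=
  {e | Measurable e ∧ ∀ (t : Icc a b) (y : Vec d), ‖e (t, y)‖ ≤ δ * (1 + ‖y‖)}

/-- The noise class `𝒦₂(δ)`. -/
def noise₂ (a b : ℝ) (d : ℕ) (δ : ℝ) : Set (Dom a b d → Vec d) :=
  {e | e ∈ noise₁ a b d δ ∧
    ∀ (t : Icc a b) (x y : Vec d), ‖e (t, x) - e (t, y)‖ ≤ δ * ‖x - y‖}

/-- The set `V_{(η,f)}(δ) = B(η,δ) × {f + e : e ∈ 𝒦(δ)}` of admissible inexact data `(η̃, f̃)`,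
for a family `𝒦` of noise classes. -/
def inexactData {a b : ℝ} {d : ℕ} (𝒦 : ℝ → Set (Dom a b d → Vec d)) (δ : ℝ)
    (q : Problem a b d) : Set (Problem a b d) :=
  {r | ‖r.1 - q.1‖ ≤ δ ∧ ∃ e ∈ 𝒦 δ, r.2 = q.2 + e}

/-! ### The Skorokhod space -/

/-- The set `D([a,b]; ℝ^d)` of functions that are right-continuous and have left limits.
(At `b` the first condition, and at `a` the second one, is void.) -/
structure Skorokhod (a b : ℝ) (d : ℕ) where
  toFun : Icc a b → Vec d
  rightCont : ∀ t, ContinuousWithinAt toFun (Ici t) t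
  leftLim : ∀ t, ∃ l, Tendsto toFun (𝓝[<] t) (𝓝 l)

/-- The Skorokhod distance
`inf_λ max (sup_t |λ(t) - t|, sup_t ‖x(t) - y(λ(t))‖)`, where `λ` runs through the increasing
bijections of `[a,b]`; it induces the Skorokhod (J₁) topology. -/
noncomputable instance (a b : ℝ) (d : ℕ) : PseudoEMetricSpace (Skorokhod a b d) where
  edist x y := ⨅ l : Icc a b ≃o Icc a b,
    max (⨆ t, edist (l t) t) (⨆ t, edist (x.toFun t) (y.toFun (l t)))
  edist_self x := by
    refine le_antisymm (iInf_le_of_le (OrderIso.refl _) ?_) bot_le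
    simp
  edist_comm := by
    have key : ∀ x y : Skorokhod a b d,
        (⨅ l : Icc a b ≃o Icc a b,
          max (⨆ t, edist (l t) t) (⨆ t, edist (x.toFun t) (y.toFun (l t)))) ≤
        ⨅ l : Icc a b ≃o Icc a b,
          max (⨆ t, edist (l t) t) (⨆ t, edist (y.toFun t) (x.toFun (l t))) := by
      intro x y
      refine le_iInf fun l => iInf_le_of_le l.symm (max_le_max ?_ ?_)
      · refine iSup_le fun t => le_iSup_of_le (l.symm t) ?_
        rw [OrderIso.apply_symm_apply, edist_comm]
      · refine iSup_le fun t => le_iSup_of_le (l.symm t) ?_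
        rw [OrderIso.apply_symm_apply, edist_comm]
    exact fun x y => le_antisymm (key x y) (key y x)
  edist_triangle x y z := by
    refine ENNReal.le_iInf_add_iInf fun l m => iInf_le_of_le (l.trans m) (max_le ?_ ?_)
    · refine iSup_le fun t => ?_
      calc edist (m (l t)) t ≤ edist (m (l t)) (l t) + edist (l t) t := edist_triangle _ _ _
        _ = edist (l t) t + edist (m (l t)) (l t) := add_comm _ _
        _ ≤ _ := add_le_add
          (le_max_of_le_left (le_iSup (fun t => edist (l t) t) t))
          (le_max_of_le_left (le_iSup (fun t => edist (m t) t) (l t)))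
    · refine iSup_le fun t => ?_
      calc edist (x.toFun t) (z.toFun (m (l t)))
          ≤ edist (x.toFun t) (y.toFun (l t)) + edist (y.toFun (l t)) (z.toFun (m (l t))) :=
            edist_triangle _ _ _
        _ ≤ _ := add_le_add
          (le_max_of_le_right (le_iSup (fun t => edist (x.toFun t) (y.toFun (l t))) t))
          (le_max_of_le_right (le_iSup (fun t => edist (y.toFun t) (z.toFun (m t))) (l t)))

/-- The Borel `σ`-field of the Skorokhod topology. -/
noncomputable instance (a b : ℝ) (d : ℕ) : MeasurableSpace (Skorokhod a b d) := borel _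

instance (a b : ℝ) (d : ℕ) : BorelSpace (Skorokhod a b d) := ⟨rfl⟩

/-! ### Randomized algorithms -/

/-- The information `f̃(t_0,y_0), …, f̃(t_{j-1},y_{j-1})`, `f̃(θ_0,z_0), …, f̃(θ_{j-1},z_{j-1})`, `η̃`,
an element of `ℝ^{(2j+1)d}`. -/
abbrev Info (d j : ℕ) : Type := (Fin j → Vec d) × (Fin j → Vec d) × Vec d

/-- An algorithm of the class `Φ` on the sample space `Ω`: it evaluates `f̃` at `i` fixed and at `i`
random times in `[a,b]`, at space points chosen adaptively by the Borel maps `ψ_j`, and returns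
the value of the Borel map `φ` at the information vector. -/
structure Algorithm (Ω : Type*) [MeasurableSpace Ω] (a b : ℝ) (d : ℕ) where
  i : ℕ
  t : Fin i → Icc a b
  θ : Fin i → Ω → Icc a b
  measurable_θ : ∀ j, Measurable (θ j)
  ψ : (j : Fin i) → Info d j → Vec d × Vec d
  measurable_ψ : ∀ j, Measurable (ψ j)
  φ : Info d i → Skorokhod a b d
  measurable_φ : Measurable φ

namespace Algorithm

variable {Ω : Type*} [MeasurableSpace Ω] {a b : ℝ} {d : ℕ}

/-- The information that is available after the first `j` steps, when the inexact data are
`r = (η̃, f̃)` and the random outcome is `ω`. -/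
def infoUpTo (A : Algorithm Ω a b d) (r : Problem a b d) (ω : Ω) :
    (j : ℕ) → j ≤ A.i → Info d j
  | 0, _ => (Fin.elim0, Fin.elim0, r.1)
  | j + 1, h =>
    let I := A.infoUpTo r ω j (Nat.le_of_succ_le h)
    let yz := A.ψ ⟨j, h⟩ I
    (Fin.snoc I.1 (r.2 (A.t ⟨j, h⟩, yz.1)), Fin.snoc I.2.1 (r.2 (A.θ ⟨j, h⟩ ω, yz.2)), r.1)

/-- The vector `N(η̃, f̃)` of noisy information. -/
def info (A : Algorithm Ω a b d) (r : Problem a b d) (ω : Ω) : Info d A.i :=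
  A.infoUpTo r ω A.i le_rfl

/-- The output `𝒜(η̃, f̃, δ) = φ(N(η̃, f̃))`. (As `δ` is known, an algorithm may be chosen
separately for each `δ`.) -/
def output (A : Algorithm Ω a b d) (r : Problem a b d) (ω : Ω) : Skorokhod a b d :=
  A.φ (A.info r ω)

/-- The number of noisy evaluations of the right-hand side. -/
def cost (A : Algorithm Ω a b d) : ℕ := 2 * A.i

/-- The error of an algorithm for the problem `q`: the supremum over all admissible inexact data of
the `L^p(Ω)` norm of the uniform distance between the solution and the output. -/
noncomputable def error (P : Measure Ω) (p : ℝ) (A : Algorithm Ω a b d)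
    (𝒦 : ℝ → Set (Dom a b d → Vec d)) (δ : ℝ) (q : Problem a b d) : ℝ≥0∞ :=
  ⨆ r ∈ inexactData 𝒦 δ q,
    (∫⁻ ω, (⨆ t : Icc a b, ‖solution q t - (A.output r ω).toFun t‖ₑ) ^ p ∂P) ^ (1 / p)

/-- The worst-case error of an algorithm over a set `G` of problems. -/
noncomputable def worstError (P : Measure Ω) (p : ℝ) (A : Algorithm Ω a b d)
    (G : Set (Problem a b d)) (𝒦 : ℝ → Set (Dom a b d → Vec d)) (δ : ℝ) : ℝ≥0∞ :=
  ⨆ q ∈ G, A.error P p 𝒦 δ q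

end Algorithm

/-- The `n`th minimal error `e_n^{(p)}(G, V, δ)`: the infimum of the worst-case error over all
algorithms that use at most `n` noisy evaluations. -/
noncomputable def minimalError {Ω : Type*} [MeasurableSpace Ω] (P : Measure Ω) (p : ℝ)
    {a b : ℝ} {d : ℕ} (n : ℕ) (G : Set (Problem a b d)) (𝒦 : ℝ → Set (Dom a b d → Vec d))
    (δ : ℝ) : ℝ≥0∞ :=
  ⨅ (A : Algorithm Ω a b d) (_ : A.cost ≤ n), A.worstError P p G 𝒦 δ

/-- The probability space carries, for every `n`, independent random variables `τ_1, …, τ_n` that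
are uniformly distributed on `(0,1)`. -/
def CarriesUniforms {Ω : Type*} [MeasurableSpace Ω] (P : Measure Ω) : Prop :=
  ∀ n : ℕ, ∃ τ : Fin n → Ω → ℝ, (∀ j, Measurable (τ j)) ∧
    (∀ j, P.map (τ j) = volume.restrict (Ioo 0 1)) ∧ iIndepFun τ P

/-- The radius `R₀ = max {R₁, R₂}`, where `R₁ = (K+2)e^{(K+1)(b-a)} + K - 1` and
`R₂ = K(1+b-a)e^{K(b-a)} + K`. -/
noncomputable def radius₀ (a b K : ℝ) : ℝ :=
  max ((K + 2) * Real.exp ((K + 1) * (b - a)) + K - 1)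
    (K * (1 + b - a) * Real.exp (K * (b - a)) + K)

end InexactODE

open InexactODE

namespace InexactODE

/-! ### Initial value problems -/

section Retraction

variable {E : Type*} [NormedAddCommGroup E] [NormedSpace ℝ E]

/-- The radial retraction of a normed space onto the closed ball with centre `η` and radius `R`. -/
noncomputable def radialRetraction (η : E) (R : ℝ) (x : E) : E :=
  η + (R / max R ‖x - η‖) • (x - η)

lemma norm_radialRetraction_sub_le_norm (η : E) {R : ℝ} (hR : 0 < R) (x : E) :
    ‖radialRetraction η R x - η‖ ≤ ‖x - η‖ := by
  have hm : 0 < max R ‖x - η‖ := lt_max_of_lt_left hR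
  rw [radialRetraction, add_sub_cancel_left, norm_smul, Real.norm_of_nonneg (by positivity)]
  exact mul_le_of_le_one_left (norm_nonneg _) ((div_le_one hm).2 (le_max_left _ _))

lemma norm_radialRetraction_sub_le_radius (η : E) {R : ℝ} (hR : 0 < R) (x : E) :
    ‖radialRetraction η R x - η‖ ≤ R := by
  have hm : 0 < max R ‖x - η‖ := lt_max_of_lt_left hR
  rw [radialRetraction, add_sub_cancel_left, norm_smul, Real.norm_of_nonneg (by positivity),
    div_mul_eq_mul_div, div_le_iff₀ hm]
  exact mul_le_mul_of_nonneg_left (le_max_right _ _) hR.le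

lemma radialRetraction_of_norm_sub_le {η : E} {R : ℝ} (hR : 0 < R) {x : E} (hx : ‖x - η‖ ≤ R) :
    radialRetraction η R x = x := by
  rw [radialRetraction, max_eq_left hx, div_self hR.ne', one_smul, add_sub_cancel]

/-- In a general normed space the radial retraction need not be nonexpansive. The change of the
vector and the change of the scaling factor each contribute at most `‖x - y‖`. -/
lemma norm_radialRetraction_sub_radialRetraction_le (η : E) {R : ℝ} (hR : 0 < R) (x y : E) :
    ‖radialRetraction η R x - radialRetraction η R y‖ ≤ 2 * ‖x - y‖ := by
  set u := x - η
  set v := y - η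
  have huv : x - y = u - v := by simp [u, v]
  have hu : 0 < max R ‖u‖ := lt_max_of_lt_left hR
  have hv : 0 < max R ‖v‖ := lt_max_of_lt_left hR
  have h1 : radialRetraction η R x - radialRetraction η R y =
      (R / max R ‖u‖) • (u - v) + (R / max R ‖u‖ - R / max R ‖v‖) • v := by
    simp only [radialRetraction, u, v]
    module
  have h2 : |max R ‖v‖ - max R ‖u‖| ≤ ‖u - v‖ := by
    have := abs_max_sub_max_le_max R ‖v‖ R ‖u‖
    rw [sub_self, abs_zero, max_eq_right (abs_nonneg (‖v‖ - ‖u‖))] at this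
    refine this.trans ?_
    rw [norm_sub_rev u v]
    exact abs_norm_sub_norm_le v u
  have h3 : |R / max R ‖u‖ - R / max R ‖v‖| * ‖v‖ ≤ ‖u - v‖ := by
    have : R / max R ‖u‖ - R / max R ‖v‖ =
        (R / max R ‖u‖) * ((max R ‖v‖ - max R ‖u‖) / max R ‖v‖) := by
      field_simp
    rw [this, abs_mul, abs_div (_ - _), abs_of_pos hv,
      abs_of_nonneg (by positivity : 0 ≤ R / max R ‖u‖)]
    calc R / max R ‖u‖ * (|max R ‖v‖ - max R ‖u‖| / max R ‖v‖) * ‖v‖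
        = R / max R ‖u‖ * (|max R ‖v‖ - max R ‖u‖| * (‖v‖ / max R ‖v‖)) := by ring
      _ ≤ 1 * (‖u - v‖ * 1) := by
        gcongr
        · exact (div_le_one hu).2 (le_max_left _ _)
        · exact (div_le_one hv).2 (le_max_right _ _)
      _ = ‖u - v‖ := by ring
  rw [h1, huv]
  refine (norm_add_le _ _).trans ?_
  rw [norm_smul, norm_smul, Real.norm_of_nonneg (by positivity), Real.norm_eq_abs, two_mul]
  exact add_le_add
    (mul_le_of_le_one_left (norm_nonneg _) ((div_le_one hu).2 (le_max_left _ _))) h3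

/-- Gronwall for `z - z a`. Growth is measured by `‖z a‖ + ‖z t - z a‖` instead of `‖z t‖` because
retraction onto a ball around `z a` decreases that quantity; so the lemma also covers retracted
equations. -/
lemma norm_sub_le_of_deriv_growth {a b K : ℝ} (hK : 0 < K) {z v : ℝ → E}
    (hz : ∀ t ∈ Icc a b, HasDerivWithinAt z (v t) (Icc a b) t)
    (hv : ∀ t ∈ Icc a b, ‖v t‖ ≤ K * (1 + (‖z a‖ + ‖z t - z a‖))) (ha : ‖z a‖ ≤ K) :
    ∀ t ∈ Icc a b, ‖z t - z a‖ ≤ (1 + K) * (Real.exp (K * (b - a)) - 1) := by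
  intro t ht
  have h := norm_le_gronwallBound_of_norm_deriv_right_le (f := fun t => z t - z a) (f' := v)
    (δ := 0) (K := K) (ε := K * (1 + K)) (a := a) (b := b)
    (fun s hs => ((hz s hs).sub_const _).continuousWithinAt)
    (fun s hs => ((hz s (Ico_subset_Icc_self hs)).sub_const _).mono_of_mem_nhdsWithin
      (Icc_mem_nhdsGE_of_mem hs))
    (by simp) (fun s hs => by
      refine (hv s (Ico_subset_Icc_self hs)).trans ?_
      nlinarith [mul_le_mul_of_nonneg_left ha hK.le]) t ht
  rw [gronwallBound_of_K_ne_0 hK.ne'] at h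
  refine h.trans ?_
  beta_reduce
  rw [zero_mul, zero_add, mul_div_cancel_left₀ _ hK.ne']
  have : Real.exp (K * (t - a)) ≤ Real.exp (K * (b - a)) := by
    gcongr
    exact ht.2
  gcongr

end Retraction

/-! ### Existence of solutions and a priori bounds. -/

section Solution

variable {a b : ℝ} {d : ℕ} {ϱ K L : ℝ}

lemma edist_le_ofReal_iff_norm_sub {E : Type*} [SeminormedAddCommGroup E] {x y : E} {R : ℝ}
    (hR : 0 ≤ R) : edist x y ≤ ENNReal.ofReal R ↔ ‖x - y‖ ≤ R := by
  rw [edist_dist, ENNReal.ofReal_le_ofReal_iff hR, dist_eq_norm]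

lemma growth_le_radius₀ (hab : a < b) (hK : 0 < K) :
    (1 + K) * (Real.exp (K * (b - a)) - 1) ≤ radius₀ a b K := by
  refine le_trans ?_ (le_max_left _ _)
  have h : Real.exp (K * (b - a)) ≤ Real.exp ((K + 1) * (b - a)) := by
    have := sub_nonneg.2 hab.le
    gcongr
    linarith
  nlinarith [Real.exp_pos ((K + 1) * (b - a)), mul_le_mul_of_nonneg_left h hK.le]

lemma radius₀_pos (hab : a < b) (hK : 0 < K) : 0 < radius₀ a b K := by
  refine lt_of_lt_of_le ?_ (growth_le_radius₀ hab hK)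
  have : 1 < Real.exp (K * (b - a)) := Real.one_lt_exp_iff.2 (mul_pos hK (sub_pos.2 hab))
  exact mul_pos (by linarith) (sub_pos.2 this)

lemma IsSolution.norm_sub_initial_le (hab : a < b) (hK : 0 < K) {R : ℝ≥0∞} {q : Problem a b d}
    (hq : q ∈ problemClass a b d ϱ K L R) {z : ℝ → Vec d} (hz : IsSolution q z) {t : ℝ}
    (ht : t ∈ Icc a b) : ‖z t - q.1‖ ≤ (1 + K) * (Real.exp (K * (b - a)) - 1) := by
  have h := norm_sub_le_of_deriv_growth hK (z := z)
    (v := fun t => q.2 (projIcc a b hab.le t, z t)) (fun s hs => by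
      simpa [projIcc_of_mem hab.le hs] using hz.2 ⟨s, hs⟩) (fun s hs => by
      refine (hq.2.2.1 _ _).trans ?_
      gcongr
      have := norm_add_le (z a) (z s - z a)
      rwa [add_sub_cancel] at this) (by rw [hz.1]; exact hq.1) t ht
  rwa [hz.1] at h

/-- Precomposing `f` with the retraction makes it bounded and globally Lipschitz in space, so
Picard–Lindelöf applies on all of `[a,b]`. By Gronwall the solution never leaves the ball, where the
retraction is the identity, hence it solves the original equation. -/
theorem exists_isSolution (hab : a < b) (hK : 0 < K) (hL : 0 < L) {R : ℝ}
    (hR : (1 + K) * (Real.exp (K * (b - a)) - 1) ≤ R) (hR₀ : 0 < R) {q : Problem a b d}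
    (hq : q ∈ problemClass a b d ϱ K L (ENNReal.ofReal R)) : ∃ z, IsSolution q z := by
  obtain ⟨η, f⟩ := q
  obtain ⟨hη, hf, hgrow, -, hlip⟩ := hq
  simp only [edist_le_ofReal_iff_norm_sub hR₀.le] at hlip hη hf hgrow
  set π := radialRetraction η R
  have hπ : ∀ x, ‖π x - η‖ ≤ R := norm_radialRetraction_sub_le_radius η hR₀
  set g : ℝ → Vec d → Vec d := fun t x => f (projIcc a b hab.le t, π x)
  have hbd : ∀ t x, ‖g t x‖ ≤ K * (1 + (‖η‖ + ‖π x - η‖)) := fun t x => by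
    refine (hgrow _ _).trans ?_
    gcongr
    have := norm_add_le η (π x - η)
    rwa [add_sub_cancel] at this
  set M : ℝ := K * (1 + (K + R))
  have hM : 0 ≤ M := by positivity
  have hgM : ∀ t x, ‖g t x‖ ≤ M := fun t x => (hbd t x).trans (by
    have := hπ x
    simp only [M]
    gcongr)
  -- A field bounded by `M` moves a point by at most `M (b-a)`, so this radius allows the whole
  -- interval; the factor 2 is the Lipschitz constant of the retraction.
  have hPL : IsPicardLindelof g (⟨a, left_mem_Icc.2 hab.le⟩ : Icc a b) η
      (M * (b - a)).toNNReal 0 M.toNNReal (L * 2).toNNReal := by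
    refine ⟨fun t _ => ?_, fun x _ => ?_, fun t _ x _ => ?_, ?_⟩
    · refine (LipschitzWith.of_dist_le_mul fun x y => ?_).lipschitzOnWith
      rw [Real.coe_toNNReal _ (by positivity), dist_eq_norm, dist_eq_norm]
      refine (hlip _ _ _ (hπ x) (hπ y)).trans ?_
      rw [mul_assoc]
      exact mul_le_mul_of_nonneg_left
        (norm_radialRetraction_sub_radialRetraction_le η hR₀ x y) hL.le
    · exact (hf.comp (continuous_projIcc.prodMk continuous_const)).continuousOn
    · rw [Real.coe_toNNReal _ hM]
      exact hgM t x
    · rw [Real.coe_toNNReal _ hM,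
        Real.coe_toNNReal _ (mul_nonneg hM (sub_nonneg.2 hab.le))]
      simp [hab.le]
  obtain ⟨z, hz0, hz⟩ := hPL.exists_eq_forall_mem_Icc_hasDerivWithinAt₀
  refine ⟨z, hz0, fun t => ?_⟩
  have hz0' : z a = η := hz0
  have h := norm_sub_le_of_deriv_growth hK hz (fun s _ => (hbd s (z s)).trans (by
    rw [hz0']
    have := norm_radialRetraction_sub_le_norm η hR₀ (z s)
    gcongr)) (by rw [hz0']; exact hη) t t.2
  have ht := hz t t.2
  simp only [g, projIcc_val] at ht
  rwa [show π (z t) = z t from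
    radialRetraction_of_norm_sub_le hR₀ (by rw [← hz0']; exact h.trans hR)] at ht

theorem isSolution_solution (hab : a < b) (hK : 0 < K) (hL : 0 < L) {q : Problem a b d}
    (hq : q ∈ problemClass a b d ϱ K L (ENNReal.ofReal (radius₀ a b K))) :
    IsSolution q (solution q) :=
  Classical.epsilon_spec
    (exists_isSolution hab hK hL (growth_le_radius₀ hab hK) (radius₀_pos hab hK) hq)

lemma problemClass_anti {R R' : ℝ≥0∞} (h : R ≤ R') :
    problemClass a b d ϱ K L R' ⊆ problemClass a b d ϱ K L R :=
  fun _ hq => ⟨hq.1, hq.2.1, hq.2.2.1, fun t s x hx => hq.2.2.2.1 t s x (hx.trans h),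
    fun t x y hx hy => hq.2.2.2.2 t x y (hx.trans h) (hy.trans h)⟩

lemma IsSolution.continuousOn {q : Problem a b d} {z : ℝ → Vec d} (hz : IsSolution q z) :
    ContinuousOn z (Icc a b) :=
  fun t ht => (hz.2 ⟨t, ht⟩).continuousWithinAt

end Solution

/-! ### Measurability of the error -/

section Measurability

variable {a b : ℝ} {d : ℕ}

/-- If the distance exceeds `c` at `t`, then a path `y` near `x` has the same property at `l t`, for
a time change `l` near the identity: `y (l t)` is near `x t`, and `z (l t)` is near `z t` by
continuity. This yields measurability of the error. -/
lemma lowerSemicontinuous_iSup_enorm_sub {z : ℝ → Vec d} (hz : ContinuousOn z (Icc a b)) :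
    LowerSemicontinuous fun x : Skorokhod a b d => ⨆ t : Icc a b, ‖z t - x.toFun t‖ₑ := by
  intro x c hc
  obtain ⟨t, ht⟩ := lt_iSup_iff.1 hc
  obtain ⟨r, hr, hcr⟩ := ENNReal.lt_iff_exists_add_pos_lt.1 ht
  have hr2 : (0 : ℝ≥0∞) < r / 2 := ENNReal.half_pos (by exact_mod_cast hr.ne')
  have hzt : ContinuousAt (fun s : Icc a b => z s) t :=
    (continuousOn_iff_continuous_domRestrict.1 hz).continuousAt
  obtain ⟨ε, hε, hball⟩ := EMetric.mem_nhds_iff.1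
    (hzt.preimage_mem_nhds (Metric.eball_mem_nhds (z t) hr2))
  filter_upwards [Metric.eball_mem_nhds x (lt_min hε hr2)] with y hy
  have hxy : edist x y < min ε (r / 2) := by rw [edist_comm]; exact hy
  obtain ⟨l, hl⟩ := iInf_lt_iff.1 hxy
  have h1 : edist (l t) t < ε :=
    ((le_iSup (fun s => edist (l s) s) t).trans (le_max_left _ _)).trans_lt
      (hl.trans_le (min_le_left _ _))
  have h2 : edist (x.toFun t) (y.toFun (l t)) ≤ r / 2 :=
    ((le_iSup (fun s => edist (x.toFun s) (y.toFun (l s))) t).trans (le_max_right _ _)).trans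
      (hl.trans_le (min_le_right _ _)).le
  have h3 : edist (z (l t)) (z t) ≤ r / 2 := (hball h1 : _ ∈ Metric.eball _ _).le
  refine lt_of_lt_of_le ?_ (le_iSup _ (l t))
  rw [← edist_eq_enorm_sub]
  rw [← edist_eq_enorm_sub] at hcr
  have h4 : edist (z t) (x.toFun t) ≤ edist (z (l t)) (y.toFun (l t)) + r :=
    calc edist (z t) (x.toFun t)
        ≤ edist (z t) (z (l t)) + edist (z (l t)) (y.toFun (l t)) +
          edist (y.toFun (l t)) (x.toFun t) := edist_triangle4 _ _ _ _
      _ ≤ r / 2 + edist (z (l t)) (y.toFun (l t)) + r / 2 := by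
        gcongr
        · rwa [edist_comm]
        · rwa [edist_comm]
      _ = edist (z (l t)) (y.toFun (l t)) + (r / 2 + r / 2) := by ring
      _ = _ := by rw [ENNReal.add_halves]
  exact lt_of_add_lt_add_right (hcr.trans_le h4)

lemma _root_.Measurable.finSnoc {Ω E : Type*} [MeasurableSpace Ω] [MeasurableSpace E] {j : ℕ}
    {f : Ω → Fin j → E} {g : Ω → E} (hf : Measurable f) (hg : Measurable g) :
    Measurable fun ω => (Fin.snoc (f ω) (g ω) : Fin (j + 1) → E) := by
  refine measurable_pi_lambda _ fun k => ?_
  refine Fin.lastCases ?_ (fun k => ?_) k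
  · simpa using hg
  · simpa using measurable_pi_iff.1 hf k

variable {Ω : Type*} [MeasurableSpace Ω]

namespace Algorithm

lemma measurable_infoUpTo (A : Algorithm Ω a b d) {r : Problem a b d} (hr : Measurable r.2) :
    ∀ (j : ℕ) (h : j ≤ A.i), Measurable fun ω => A.infoUpTo r ω j h
  | 0, _ => measurable_const
  | j + 1, h => by
    have ih := A.measurable_infoUpTo hr j (Nat.le_of_succ_le h)
    have hyz := (A.measurable_ψ ⟨j, h⟩).comp ih
    exact (ih.fst.finSnoc (hr.comp (measurable_const.prodMk hyz.fst))).prodMk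
      ((ih.snd.fst.finSnoc (hr.comp ((A.measurable_θ ⟨j, h⟩).prodMk hyz.snd))).prodMk
        measurable_const)

lemma measurable_output (A : Algorithm Ω a b d) {r : Problem a b d} (hr : Measurable r.2) :
    Measurable (A.output r) :=
  A.measurable_φ.comp (A.measurable_infoUpTo hr _ _)

/-- The sampling times do not depend on the data. Agreement at these times for every space point
therefore propagates through the adaptive choice of the space points. -/
lemma infoUpTo_congr (A : Algorithm Ω a b d) {r r' : Problem a b d} {ω : Ω} (h₁ : r.1 = r'.1)
    (ht : ∀ j y, r.2 (A.t j, y) = r'.2 (A.t j, y))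
    (hθ : ∀ j y, r.2 (A.θ j ω, y) = r'.2 (A.θ j ω, y)) :
    ∀ (j : ℕ) (h : j ≤ A.i), A.infoUpTo r ω j h = A.infoUpTo r' ω j h
  | 0, _ => by simp [infoUpTo, h₁]
  | j + 1, h => by
    simp only [infoUpTo, A.infoUpTo_congr h₁ ht hθ j (Nat.le_of_succ_le h), ht, hθ, h₁]

lemma output_congr (A : Algorithm Ω a b d) {r r' : Problem a b d} {ω : Ω} (h₁ : r.1 = r'.1)
    (ht : ∀ j y, r.2 (A.t j, y) = r'.2 (A.t j, y))
    (hθ : ∀ j y, r.2 (A.θ j ω, y) = r'.2 (A.θ j ω, y)) : A.output r ω = A.output r' ω :=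
  congrArg A.φ (A.infoUpTo_congr h₁ ht hθ _ _)

/-- The uniform distance between the solution of `q` and the output for the data `r`. -/
noncomputable def pathError (A : Algorithm Ω a b d) (q r : Problem a b d) (ω : Ω) : ℝ≥0∞ :=
  ⨆ t : Icc a b, ‖solution q t - (A.output r ω).toFun t‖ₑ

lemma measurable_pathError (A : Algorithm Ω a b d) {q r : Problem a b d}
    (hq : IsSolution q (solution q)) (hr : Measurable r.2) : Measurable (A.pathError q r) :=
  (lowerSemicontinuous_iSup_enorm_sub hq.continuousOn).measurable.comp (A.measurable_output hr)

/-- A lower bound for the worst-case error by averaging over a finite family of problems. -/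
theorem le_worstError_of_sum {P : Measure Ω} [IsProbabilityMeasure P] {p : ℝ} (hp : 2 ≤ p)
    (A : Algorithm Ω a b d) {G : Set (Problem a b d)} {𝒦 : ℝ → Set (Dom a b d → Vec d)} {δ : ℝ}
    {S : Type*} [Fintype S] [Nonempty S] {q r : S → Problem a b d} (hqG : ∀ s, q s ∈ G)
    (hq : ∀ s, IsSolution (q s) (solution (q s))) (hr : ∀ s, r s ∈ inexactData 𝒦 δ (q s))
    (hrm : ∀ s, Measurable (r s).2) {v : ℝ≥0∞}
    (hv : ∀ ω, Fintype.card S * v ^ (2 : ℝ) ≤ ∑ s, A.pathError (q s) (r s) ω ^ (2 : ℝ)) :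
    v ≤ A.worstError P p G 𝒦 δ := by
  have h1 : ∀ s, ∫⁻ ω, A.pathError (q s) (r s) ω ^ (2 : ℝ) ∂P ≤
      A.worstError P p G 𝒦 δ ^ (2 : ℝ) := by
    intro s
    have hm := A.measurable_pathError (hq s) (hrm s)
    -- On a probability space the `L²` norm is at most the `L^p` norm; squares are what averaging
    -- over signs can evaluate.
    have h := eLpNorm'_le_eLpNorm'_of_exponent_le two_pos hp P hm.aestronglyMeasurable
    simp only [eLpNorm', enorm_eq_self] at h
    have h' : (∫⁻ ω, A.pathError (q s) (r s) ω ^ p ∂P) ^ (1 / p) ≤ A.worstError P p G 𝒦 δ :=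
      (le_iSup₂_of_le (f := fun r' (_ : r' ∈ inexactData 𝒦 δ (q s)) =>
        (∫⁻ ω, A.pathError (q s) r' ω ^ p ∂P) ^ (1 / p)) (r s) (hr s) le_rfl).trans
        (le_iSup₂_of_le (f := fun q' (_ : q' ∈ G) => A.error P p 𝒦 δ q') (q s) (hqG s) le_rfl)
    have h'' := ENNReal.rpow_le_rpow (h.trans h') (zero_le_two (α := ℝ))
    rwa [← ENNReal.rpow_mul, one_div_mul_cancel two_ne_zero, ENNReal.rpow_one] at h''
  have h2 : Fintype.card S * v ^ (2 : ℝ) ≤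
      Fintype.card S * A.worstError P p G 𝒦 δ ^ (2 : ℝ) := by
    calc Fintype.card S * v ^ (2 : ℝ)
        = ∫⁻ _, Fintype.card S * v ^ (2 : ℝ) ∂P := by simp
      _ ≤ ∫⁻ ω, ∑ s, A.pathError (q s) (r s) ω ^ (2 : ℝ) ∂P := lintegral_mono hv
      _ = ∑ s, ∫⁻ ω, A.pathError (q s) (r s) ω ^ (2 : ℝ) ∂P :=
        lintegral_finsetSum _ fun s _ =>
          (A.measurable_pathError (hq s) (hrm s)).pow_const _
      _ ≤ ∑ _ : S, A.worstError P p G 𝒦 δ ^ (2 : ℝ) := Finset.sum_le_sum fun s _ => h1 s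
      _ = _ := by simp
  rw [ENNReal.mul_le_mul_iff_right (by simp) (by simp)] at h2
  exact (ENNReal.rpow_le_rpow_iff two_pos).1 h2

end Algorithm

lemma le_minimalError {P : Measure Ω} {p : ℝ} {n : ℕ} {G : Set (Problem a b d)}
    {𝒦 : ℝ → Set (Dom a b d → Vec d)} {δ : ℝ} {v : ℝ≥0∞}
    (h : ∀ A : Algorithm Ω a b d, A.cost ≤ n → v ≤ A.worstError P p G 𝒦 δ) :
    v ≤ minimalError P p n G 𝒦 δ :=
  le_iInf₂ h

lemma minimalError_mono (P : Measure Ω) (p : ℝ) (n : ℕ) {G G' : Set (Problem a b d)}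
    {𝒦 𝒦' : ℝ → Set (Dom a b d → Vec d)} {δ : ℝ} (hG : G ⊆ G') (h𝒦 : 𝒦 δ ⊆ 𝒦' δ) :
    minimalError P p n G 𝒦 δ ≤ minimalError P p n G' 𝒦' δ := by
  refine iInf₂_mono fun A _ => iSup₂_le fun q hq => ?_
  refine le_trans (iSup₂_le fun r hr => ?_) (le_iSup₂ (f := fun q _ => A.error P p 𝒦' δ q) q (hG hq))
  obtain ⟨h1, e, he, h2⟩ := hr
  exact le_iSup₂ (f := fun r (_ : r ∈ inexactData 𝒦' δ q) =>
    (∫⁻ ω, (⨆ t : Icc a b, ‖solution q t - (A.output r ω).toFun t‖ₑ) ^ p ∂P) ^ (1 / p))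
    r ⟨h1, e, h𝒦 he, h2⟩

end Measurability

/-! ### Random signs -/

section Signs

/-- The sign `1` or `-1` that is encoded by a Boolean. -/
def sign (s : Bool) : ℝ := if s then 1 else -1

lemma sign_not (s : Bool) : sign (!s) = -sign s := by cases s <;> simp [sign]

lemma sign_mul_self (s : Bool) : sign s * sign s = 1 := by cases s <;> simp [sign]

lemma abs_sign (s : Bool) : |sign s| = 1 := by cases s <;> simp [sign]

variable {ι : Type*} [DecidableEq ι]

/-- Flipping the signs with index in `U`. -/
def flipOn (U : Finset ι) : (ι → Bool) ≃ (ι → Bool) :=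
  Function.Involutive.toPerm (fun ε k => if k ∈ U then !ε k else ε k) fun ε => by
    funext k
    by_cases h : k ∈ U <;> simp [h]

lemma flipOn_apply (U : Finset ι) (ε : ι → Bool) (k : ι) :
    flipOn U ε k = if k ∈ U then !ε k else ε k := rfl

variable [Fintype ι]

/-- For `k ≠ l`, flipping the `k`-th sign is a bijection that negates the sum. -/
lemma sum_sign_mul_sign (k l : ι) :
    ∑ ε : ι → Bool, sign (ε k) * sign (ε l) = if k = l then 2 ^ Fintype.card ι else 0 := by
  split_ifs with h
  · subst h
    simp [sign_mul_self]
  · have := Equiv.sum_comp (flipOn {k}) fun ε : ι → Bool => sign (ε k) * sign (ε l)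
    simp only [flipOn_apply, Finset.mem_singleton, if_true, if_neg (Ne.symm h), sign_not,
      neg_mul, Finset.sum_neg_distrib] at this
    linarith

lemma sum_sq_sum_sign (U : Finset ι) (x : ι → ℝ) :
    ∑ ε : ι → Bool, (∑ k ∈ U, sign (ε k) * x k) ^ 2 =
      2 ^ Fintype.card ι * ∑ k ∈ U, x k ^ 2 := by
  have : ∀ ε : ι → Bool, (∑ k ∈ U, sign (ε k) * x k) ^ 2 =
      ∑ k ∈ U, ∑ l ∈ U, x k * x l * (sign (ε k) * sign (ε l)) := fun ε => by
    rw [sq, Finset.sum_mul_sum]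
    exact Finset.sum_congr rfl fun k _ => Finset.sum_congr rfl fun l _ => by ring
  simp_rw [this]
  rw [Finset.sum_comm, Finset.mul_sum]
  refine Finset.sum_congr rfl fun k hk => ?_
  rw [Finset.sum_comm]
  simp_rw [← Finset.mul_sum, sum_sign_mul_sign]
  simp only [mul_ite, mul_zero, Finset.sum_ite_eq, hk, if_true]
  ring

/-- Convexity of the square: two indistinguishable problems whose solutions are `2c` apart have mean
squared error at least `c²`. -/
lemma two_mul_rpow_two_le_of_two_mul_le_add {x y c : ℝ≥0∞} (h : 2 * c ≤ x + y) :
    2 * c ^ (2 : ℝ) ≤ x ^ (2 : ℝ) + y ^ (2 : ℝ) := by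
  have h1 := (ENNReal.rpow_le_rpow h zero_le_two).trans
    (ENNReal.rpow_add_le_mul_rpow_add_rpow x y one_le_two)
  rw [ENNReal.mul_rpow_of_nonneg _ _ zero_le_two] at h1
  have h2 : (2 : ℝ≥0∞) ^ (2 : ℝ) = 2 * 2 := by
    rw [ENNReal.rpow_two, sq]
  have h3 : (2 : ℝ≥0∞) ^ ((2 : ℝ) - 1) = 2 := by norm_num
  rw [h2, h3, mul_assoc] at h1
  exact (ENNReal.mul_le_mul_iff_right (by simp) (by simp)).1 h1

end Signs

/-! ### Right-hand sides that depend on time only -/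

section Quadrature

variable {a b : ℝ} {d : ℕ} {ϱ K L : ℝ}

/-- The initial value problem `z'(t) = u(t) e`, `z(a) = η`. -/
def timeProblem (a b : ℝ) (e η : Vec d) (u : ℝ → ℝ) : Problem a b d :=
  (η, fun x => u x.1 • e)

lemma continuous_timeProblem (e η : Vec d) {u : ℝ → ℝ} (hu : Continuous u) :
    Continuous (timeProblem a b e η u).2 :=
  (hu.comp (continuous_subtype_val.comp continuous_fst)).smul continuous_const

lemma timeProblem_mem (hL : 0 ≤ L) {e η : Vec d} {u : ℝ → ℝ}
    (he : ‖e‖ = 1) (hη : ‖η‖ ≤ K) (hu : Continuous u) (hbd : ∀ t, |u t| ≤ K)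
    (hhol : ∀ t s, |u t - u s| ≤ L * |t - s| ^ ϱ) :
    timeProblem a b e η u ∈ problemClass a b d ϱ K L ⊤ := by
  refine ⟨hη, continuous_timeProblem e η hu, fun t x => ?_, fun t s x _ => ?_,
    fun t x y _ _ => ?_⟩
  · rw [timeProblem, norm_smul, he, mul_one, Real.norm_eq_abs]
    refine (hbd t).trans (le_mul_of_one_le_right ((abs_nonneg _).trans (hbd t)) ?_)
    linarith [norm_nonneg x]
  · simp only [timeProblem]
    rw [← sub_smul, norm_smul, he, mul_one, Real.norm_eq_abs]
    exact hhol t s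
  · simp only [timeProblem, sub_self, norm_zero]
    positivity

lemma IsSolution.apply_timeProblem (hab : a < b) {e η : Vec d} {u : ℝ → ℝ} (hu : Continuous u)
    {z : ℝ → Vec d} (hz : IsSolution (timeProblem a b e η u) z) :
    z b = η + (∫ t in a..b, u t) • e := by
  have h := intervalIntegral.integral_eq_sub_of_hasDerivAt_of_le hab.le hz.continuousOn
    (f' := fun t => u t • e)
    (fun t ht => (hz.2 ⟨t, Ioo_subset_Icc_self ht⟩).hasDerivAt (Icc_mem_nhds ht.1 ht.2))
    ((hu.smul continuous_const).intervalIntegrable _ _)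
  rw [intervalIntegral.integral_smul_const, hz.1] at h
  rw [h]
  simp [timeProblem]

lemma exists_norm_eq_one (hd : 1 ≤ d) : ∃ e : Vec d, ‖e‖ = 1 := by
  refine ⟨PiLp.single 1 ⟨0, hd⟩ 1, ?_⟩
  rw [PiLp.norm_single]
  simp

lemma isSolution_timeProblem (hab : a < b) (hK : 0 < K) (hL : 0 < L) {q : Problem a b d}
    (hq : q ∈ problemClass a b d ϱ K L ⊤) : IsSolution q (solution q) :=
  isSolution_solution hab hK hL (problemClass_anti le_top hq)

lemma zero_mem_noise₂ {δ : ℝ} (hδ : 0 ≤ δ) : (0 : Dom a b d → Vec d) ∈ noise₂ a b d δ :=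
  ⟨⟨measurable_zero, fun t y => by simp; positivity⟩, fun t x y => by simp; positivity⟩

variable {Ω : Type*} [MeasurableSpace Ω]

/-- Triangle inequality at time `b` through the common output. -/
lemma Algorithm.enorm_sub_le_pathError_add (A : Algorithm Ω a b d) (hab : a ≤ b)
    {q q' r r' : Problem a b d} {ω : Ω} (h : A.output r ω = A.output r' ω) :
    ‖solution q b - solution q' b‖ₑ ≤ A.pathError q r ω + A.pathError q' r' ω := by
  let β : Icc a b := ⟨b, right_mem_Icc.2 hab⟩
  have h1 : ‖solution q b - (A.output r ω).toFun β‖ₑ ≤ A.pathError q r ω :=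
    le_iSup (fun t : Icc a b => ‖solution q t - (A.output r ω).toFun t‖ₑ) β
  have h2 : ‖solution q' b - (A.output r ω).toFun β‖ₑ ≤ A.pathError q' r' ω := by
    rw [h]
    exact le_iSup (fun t : Icc a b => ‖solution q' t - (A.output r' ω).toFun t‖ₑ) β
  rw [← edist_eq_enorm_sub] at *
  exact (edist_triangle_right _ _ _).trans (add_le_add h1 h2)

/-- The constant solutions `δe` and `-δe` share the data `(0, 0)`: only the initial value is
perturbed. The condition `δ ≤ K` puts both initial values into the class. -/
theorem ofReal_noise_le_minimalError (hab : a < b) (hd : 1 ≤ d) (hK : 0 < K) (hL : 0 < L)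
    {p : ℝ} (hp : 2 ≤ p) {P : Measure Ω} [IsProbabilityMeasure P] (n : ℕ) {δ : ℝ} (hδ : 0 ≤ δ)
    (hδK : δ ≤ K) :
    ENNReal.ofReal δ ≤ minimalError P p n (problemClass a b d ϱ K L ⊤) (noise₂ a b d) δ := by
  refine le_minimalError fun A _ => ?_
  obtain ⟨e, he⟩ := exists_norm_eq_one hd
  set q : Bool → Problem a b d := fun s => timeProblem a b e ((sign s * δ) • e) 0
  have hnorm : ∀ s, ‖(sign s * δ) • e‖ = δ := fun s => by
    rw [norm_smul, he, mul_one, norm_mul, Real.norm_eq_abs, abs_sign, one_mul,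
      Real.norm_of_nonneg hδ]
  have hq : ∀ s, q s ∈ problemClass a b d ϱ K L ⊤ := fun s =>
    timeProblem_mem hL.le he ((hnorm s).trans_le hδK) continuous_zero (fun t => by simp [hK.le])
      (fun t s => by simp; positivity)
  have hsol := fun s => isSolution_timeProblem hab hK hL (hq s)
  have hval : ∀ s, solution (q s) b = (sign s * δ) • e := fun s => by
    rw [(hsol s).apply_timeProblem hab continuous_zero]
    simp
  refine A.le_worstError_of_sum hp (q := q) (r := fun _ => timeProblem a b e 0 0) hq hsol
    (fun s => ⟨?_, 0, zero_mem_noise₂ hδ, ?_⟩)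
    (fun s => (continuous_timeProblem e 0 continuous_zero).measurable) fun ω => ?_
  · simp only [timeProblem, q, zero_sub, norm_neg, hnorm, le_refl]
  · simp [timeProblem, q]
  · simp only [Fintype.card_bool, Fintype.sum_bool, Nat.cast_ofNat]
    refine two_mul_rpow_two_le_of_two_mul_le_add ?_
    refine le_trans (le_of_eq ?_) (A.enorm_sub_le_pathError_add hab.le rfl)
    rw [hval, hval, ← sub_smul, enorm_smul, ← ofReal_norm (x := e), he, ENNReal.ofReal_one, mul_one,
      Real.enorm_eq_ofReal_abs, ← sub_mul, abs_mul, abs_of_nonneg hδ,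
      ENNReal.ofReal_mul (abs_nonneg _)]
    norm_num [sign]

end Quadrature

/-! ### Sums of tent functions with disjoint supports -/

section Tent

/-- The tent function with slope `1` on the `k`-th cell of length `w`, counted from `a`. -/
noncomputable def tent (a w : ℝ) (k : ℕ) (t : ℝ) : ℝ :=
  max 0 (w / 2 - |t - (a + (k + 1 / 2) * w)|)

variable {a w : ℝ}

lemma tent_nonneg (k : ℕ) (t : ℝ) : 0 ≤ tent a w k t := le_max_left _ _

lemma tent_le (hw : 0 ≤ w) (k : ℕ) (t : ℝ) : tent a w k t ≤ w / 2 :=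
  max_le (by positivity) (by linarith [abs_nonneg (t - (a + (k + 1 / 2) * w))])

lemma continuous_tent (k : ℕ) : Continuous (tent a w k) := by
  unfold tent
  fun_prop

lemma abs_tent_sub_tent_le (k : ℕ) (t s : ℝ) : |tent a w k t - tent a w k s| ≤ |t - s| := by
  refine (abs_max_sub_max_le_max _ _ _ _).trans ?_
  rw [sub_self, abs_zero, max_eq_right (abs_nonneg _)]
  refine le_trans (le_of_eq ?_) ((abs_abs_sub_abs_le (s - (a + (k + 1 / 2) * w))
    (t - (a + (k + 1 / 2) * w))).trans (le_of_eq ?_))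
  · congr 1
    ring
  · rw [abs_sub_comm]
    congr 1
    ring

lemma eq_of_tent_ne_zero {k l : ℕ} {t : ℝ} (hk : tent a w k t ≠ 0) (hl : tent a w l t ≠ 0) :
    k = l := by
  have key : ∀ j : ℕ, tent a w j t ≠ 0 → |t - (a + (j + 1 / 2) * w)| < w / 2 := fun j hj => by
    by_contra h
    exact hj (max_eq_left (by linarith))
  have h1 := key k hk
  have h2 := key l hl
  have hw : 0 < w := by linarith [abs_nonneg (t - (a + (k + 1 / 2) * w))]
  rw [abs_lt] at h1 h2
  have h3 : ((k : ℝ) - l) * w < 1 * w := by linarith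
  have h4 : ((l : ℝ) - k) * w < 1 * w := by linarith
  have h5 : (k : ℝ) < l + 1 := by linarith [lt_of_mul_lt_mul_right h3 hw.le]
  have h6 : (l : ℝ) < k + 1 := by linarith [lt_of_mul_lt_mul_right h4 hw.le]
  norm_cast at h5 h6
  omega

/-- On the middle half of its cell, of length `w/2`, the tent is at least `w/4`. -/
lemma sq_div_eight_le_integral_tent {b : ℝ} (hw : 0 ≤ w) {k : ℕ} (hk : a + (k + 1) * w ≤ b) :
    w ^ 2 / 8 ≤ ∫ t in a..b, tent a w k t := by
  set m := a + (k + 1 / 2) * w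
  have hm : a ≤ m - w / 4 := by
    have : (0 : ℝ) ≤ k * w := by positivity
    simp only [m]
    linarith
  have hm' : m + w / 4 ≤ b := by
    simp only [m]
    linarith
  calc w ^ 2 / 8 = ∫ _ in (m - w / 4)..(m + w / 4), w / 4 := by
        rw [intervalIntegral.integral_const, smul_eq_mul]
        ring
    _ ≤ ∫ t in (m - w / 4)..(m + w / 4), tent a w k t := by
        refine intervalIntegral.integral_mono_on (by linarith) (by simp)
          ((continuous_tent k).intervalIntegrable _ _) fun t ht => ?_
        refine le_max_of_le_right ?_
        have : |t - m| ≤ w / 4 := abs_le.2 ⟨by linarith [ht.1], by linarith [ht.2]⟩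
        simp only [m] at this
        linarith
    _ ≤ _ := intervalIntegral.integral_mono_interval hm (by linarith) hm'
        (Eventually.of_forall fun t => tent_nonneg k t)
        ((continuous_tent k).intervalIntegrable _ _)

variable {N : ℕ}

lemma exists_forall_tent_eq_zero (hN : 0 < N) (t : ℝ) :
    ∃ k₀ : Fin N, ∀ k : Fin N, k ≠ k₀ → tent a w k t = 0 := by
  by_cases h : ∃ k₀ : Fin N, tent a w k₀ t ≠ 0
  · obtain ⟨k₀, h₀⟩ := h
    exact ⟨k₀, fun k hk => by_contra fun h => hk (Fin.ext (eq_of_tent_ne_zero h h₀))⟩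
  -- Where all tents vanish, any index serves; here `N > 0` is needed.
  · push Not at h
    exact ⟨⟨0, hN⟩, fun k _ => h k⟩

lemma abs_sum_sign_mul_tent_le (hN : 0 < N) (hw : 0 ≤ w) (ε : Fin N → Bool) (t : ℝ) :
    |∑ k, sign (ε k) * tent a w k t| ≤ w / 2 := by
  obtain ⟨k₀, h₀⟩ := exists_forall_tent_eq_zero (a := a) (w := w) hN t
  rw [Finset.sum_eq_single k₀ (fun k _ hk => by rw [h₀ k hk, mul_zero]) (by simp), abs_mul,
    abs_sign, one_mul, abs_of_nonneg (tent_nonneg _ _)]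
  exact tent_le hw _ _

/-- At most two tents are nonzero at `t` or at `s`, and each is 1-Lipschitz. -/
lemma abs_sum_sign_mul_tent_sub_le (hN : 0 < N) (ε : Fin N → Bool) (t s : ℝ) :
    |∑ k, sign (ε k) * tent a w k t - ∑ k, sign (ε k) * tent a w k s| ≤ 2 * |t - s| := by
  obtain ⟨k₀, h₀⟩ := exists_forall_tent_eq_zero (a := a) (w := w) hN t
  obtain ⟨k₁, h₁⟩ := exists_forall_tent_eq_zero (a := a) (w := w) hN s
  rw [← Finset.sum_sub_distrib]
  refine (Finset.abs_sum_le_sum_abs _ _).trans ?_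
  have h : ∑ k : Fin N, |sign (ε k) * tent a w k t - sign (ε k) * tent a w k s| =
      ∑ k ∈ {k₀, k₁}, |sign (ε k) * tent a w k t - sign (ε k) * tent a w k s| := by
    refine (Finset.sum_subset (Finset.subset_univ _) fun k _ hk => ?_).symm
    simp only [Finset.mem_insert, Finset.mem_singleton, not_or] at hk
    rw [h₀ k hk.1, h₁ k hk.2, sub_self, abs_zero]
  rw [h]
  refine (Finset.sum_le_card_nsmul _ _ |t - s| fun k _ => ?_).trans ?_
  · rw [← mul_sub, abs_mul, abs_sign, one_mul]
    exact abs_tent_sub_tent_le _ _ _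
  · rw [nsmul_eq_mul]
    gcongr
    exact_mod_cast Finset.card_le_two

lemma min_le_rpow_mul_rpow {x y ϱ : ℝ} (hx : 0 ≤ x) (hy : 0 ≤ y) (hϱ₀ : 0 ≤ ϱ) (hϱ₁ : ϱ ≤ 1) :
    min x y ≤ x ^ ϱ * y ^ (1 - ϱ) := by
  have hm : 0 ≤ min x y := le_min hx hy
  calc min x y = min x y ^ (ϱ + (1 - ϱ)) := by rw [add_sub_cancel, Real.rpow_one]
    _ = min x y ^ ϱ * min x y ^ (1 - ϱ) :=
      Real.rpow_add_of_nonneg hm hϱ₀ (sub_nonneg.2 hϱ₁)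
    _ ≤ _ := mul_le_mul (Real.rpow_le_rpow hm (min_le_left _ _) hϱ₀)
      (Real.rpow_le_rpow hm (min_le_right _ _) (sub_nonneg.2 hϱ₁)) (by positivity)
      (by positivity)

/-- A signed sum of tents of height `c w^ϱ / 2`. -/
noncomputable def tentSum (a w c ϱ : ℝ) {N : ℕ} (ε : Fin N → Bool) (t : ℝ) : ℝ :=
  c * w ^ (ϱ - 1) * ∑ k, sign (ε k) * tent a w k t

variable {c ϱ : ℝ}

lemma continuous_tentSum (ε : Fin N → Bool) : Continuous (tentSum a w c ϱ ε) :=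
  continuous_const.mul (continuous_finsetSum _ fun k _ => continuous_const.mul (continuous_tent k))

lemma abs_tentSum_le (hN : 0 < N) (hw : 0 < w) (hc : 0 ≤ c) (ε : Fin N → Bool) (t : ℝ) :
    |tentSum a w c ϱ ε t| ≤ c * w ^ ϱ := by
  rw [tentSum, abs_mul, abs_of_nonneg (by positivity)]
  calc c * w ^ (ϱ - 1) * |∑ k, sign (ε k) * tent a w k t|
      ≤ c * w ^ (ϱ - 1) * w := by
        gcongr
        exact (abs_sum_sign_mul_tent_le hN hw.le ε t).trans (by linarith)
    _ = c * w ^ ϱ := by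
        rw [mul_assoc, ← Real.rpow_add_one hw.ne', sub_add_cancel]

/-- Interpolation between the Lipschitz bound `2|t - s|` and the sup bound `2w`: their minimum is at
most `2|t - s|^ϱ w^(1-ϱ)`, and the prefactor `w^(ϱ-1)` cancels the power of `w`. -/
lemma abs_tentSum_sub_le (hN : 0 < N) (hw : 0 < w) (hc : 0 ≤ c) (hϱ₀ : 0 ≤ ϱ) (hϱ₁ : ϱ ≤ 1)
    (ε : Fin N → Bool) (t s : ℝ) :
    |tentSum a w c ϱ ε t - tentSum a w c ϱ ε s| ≤ 2 * c * |t - s| ^ ϱ := by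
  rw [tentSum, tentSum, ← mul_sub, abs_mul, abs_of_nonneg (by positivity)]
  have h1 := abs_sum_sign_mul_tent_sub_le (a := a) (w := w) hN ε t s
  have h2 : |∑ k, sign (ε k) * tent a w k t - ∑ k, sign (ε k) * tent a w k s| ≤ 2 * w := by
    refine (abs_sub _ _).trans ?_
    linarith [abs_sum_sign_mul_tent_le (a := a) hN hw.le ε t,
      abs_sum_sign_mul_tent_le (a := a) hN hw.le ε s]
  have h3 := min_le_rpow_mul_rpow (abs_nonneg (t - s)) hw.le hϱ₀ hϱ₁
  calc c * w ^ (ϱ - 1) * |∑ k, sign (ε k) * tent a w k t - ∑ k, sign (ε k) * tent a w k s|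
      ≤ c * w ^ (ϱ - 1) * (2 * (|t - s| ^ ϱ * w ^ (1 - ϱ))) := by
        gcongr
        refine le_trans ?_ (mul_le_mul_of_nonneg_left h3 zero_le_two)
        rw [mul_min_of_nonneg _ _ zero_le_two]
        exact le_min h1 h2
    _ = 2 * c * |t - s| ^ ϱ * (w ^ (ϱ - 1) * w ^ (1 - ϱ)) := by ring
    _ = _ := by
        rw [← Real.rpow_add hw]
        simp

lemma integral_tentSum (b : ℝ) (ε : Fin N → Bool) :
    ∫ t in a..b, tentSum a w c ϱ ε t =
      ∑ k : Fin N, sign (ε k) * (c * w ^ (ϱ - 1) * ∫ t in a..b, tent a w k t) := by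
  simp only [tentSum]
  rw [intervalIntegral.integral_const_mul, intervalIntegral.integral_finsetSum
    (f := fun (k : Fin N) t => sign (ε k) * tent a w k t)
    fun k _ => (continuous_const.mul (continuous_tent _)).intervalIntegrable _ _, Finset.mul_sum]
  refine Finset.sum_congr rfl fun k _ => ?_
  rw [intervalIntegral.integral_const_mul]
  ring

lemma tentSum_flipOn {U : Finset (Fin N)} {t : ℝ} (h : ∀ k ∈ U, tent a w k t = 0)
    (ε : Fin N → Bool) : tentSum a w c ϱ (flipOn U ε) t = tentSum a w c ϱ ε t := by
  rw [tentSum, tentSum]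
  congr 1
  refine Finset.sum_congr rfl fun k _ => ?_
  rw [flipOn_apply]
  split_ifs with hk
  · rw [h k hk, mul_zero, mul_zero]
  · rfl

/-- Every point of a sample meets the support of at most one tent. -/
lemma exists_unsampled {ι : Type*} [Fintype ι] (x : ι → ℝ) :
    ∃ U : Finset (Fin N), N ≤ U.card + Fintype.card ι ∧
      ∀ k ∈ U, ∀ j, tent a w k (x j) = 0 := by
  classical
  refine ⟨Finset.univ.filter fun k => ∀ j, tent a w k (x j) = 0, ?_, by simp⟩
  -- A tent is unsampled or hit by some node, and each node hits at most one tent.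
  have h : (Finset.univ : Finset (Fin N)) ⊆
      (Finset.univ.filter fun k => ∀ j, tent a w k (x j) = 0) ∪
        Finset.univ.biUnion fun j => Finset.univ.filter fun k : Fin N => tent a w k (x j) ≠ 0 := by
    intro k _
    by_cases hk : ∀ j, tent a w k (x j) = 0
    · simp [hk]
    · push Not at hk
      simp [hk]
  have h' := (Finset.card_le_card h).trans (Finset.card_union_le _ _)
  rw [Finset.card_univ, Fintype.card_fin] at h'
  refine h'.trans (Nat.add_le_add_left ?_ _)
  refine (Finset.card_biUnion_le_card_mul _ _ 1 fun j _ => ?_).trans (by simp)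
  refine Finset.card_le_one.2 fun k hk l hl => ?_
  exact Fin.ext (eq_of_tent_ne_zero (Finset.mem_filter.1 hk).2 (Finset.mem_filter.1 hl).2)

end Tent

/-! ### The lower bound from finite information. -/

section

variable {a b : ℝ} {d : ℕ} {ϱ K L : ℝ} {Ω : Type*} [MeasurableSpace Ω]

/-- Exact data suffice here. The factor `√n` appears because the unseen signs are orthogonal: `n`
unseen contributions, each at least `v` in size, add up in mean square. -/
theorem ofReal_sqrt_mul_le_minimalError (hab : a < b) (hd : 1 ≤ d) (hK : 0 < K) (hL : 0 < L)
    (hϱ₀ : 0 ≤ ϱ) (hϱ₁ : ϱ ≤ 1) {p : ℝ} (hp : 2 ≤ p) {P : Measure Ω} [IsProbabilityMeasure P]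
    {n : ℕ} (hn : 0 < n) {δ : ℝ} (hδ : 0 ≤ δ) {c w : ℝ} (hc : 0 < c) (hcL : 2 * c ≤ L)
    (hw : w = (b - a) / (2 * n)) (hcK : c * w ^ ϱ ≤ K) :
    ENNReal.ofReal (√n * (c * w ^ (ϱ - 1) * (w ^ 2 / 8))) ≤
      minimalError P p n (problemClass a b d ϱ K L ⊤) (noise₂ a b d) δ := by
  refine le_minimalError fun A hA => ?_
  obtain ⟨e, he⟩ := exists_norm_eq_one hd
  have hn' : (0 : ℝ) < n := by exact_mod_cast hn
  have hw₀ : 0 < w := by rw [hw]; exact div_pos (sub_pos.2 hab) (by positivity)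
  have hN : 0 < 2 * n := by omega
  set q : (Fin (2 * n) → Bool) → Problem a b d := fun ε =>
    timeProblem a b e 0 (tentSum a w c ϱ ε)
  have hq : ∀ ε, q ε ∈ problemClass a b d ϱ K L ⊤ := fun ε =>
    timeProblem_mem hL.le he (by simp [hK.le]) (continuous_tentSum ε)
      (fun t => (abs_tentSum_le hN hw₀ hc.le ε t).trans hcK)
      (fun t s => (abs_tentSum_sub_le hN hw₀ hc.le hϱ₀ hϱ₁ ε t s).trans (by gcongr))
  have hsol := fun ε => isSolution_timeProblem hab hK hL (hq ε)
  set x : Fin (2 * n) → ℝ := fun k => c * w ^ (ϱ - 1) * ∫ t in a..b, tent a w k t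
  set v := c * w ^ (ϱ - 1) * (w ^ 2 / 8)
  have hv : 0 ≤ v := by positivity
  have hx : ∀ k, v ≤ x k := fun k => by
    have hk : a + ((k : ℕ) + 1) * w ≤ b := by
      have h1 : (((k : ℕ) : ℝ) + 1) ≤ 2 * n := by exact_mod_cast k.2
      have h2 : 2 * n * w = b - a := by
        rw [hw]
        field_simp
      linarith [mul_le_mul_of_nonneg_right h1 hw₀.le]
    exact mul_le_mul_of_nonneg_left (sq_div_eight_le_integral_tent hw₀.le hk) (by positivity)
  have hval : ∀ ε, solution (q ε) b = (∑ k, sign (ε k) * x k) • e := fun ε => by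
    rw [(hsol ε).apply_timeProblem hab (continuous_tentSum ε), integral_tentSum, zero_add]
  refine A.le_worstError_of_sum hp (q := q) (r := q) hq hsol
    (fun ε => ⟨by simpa using hδ, 0, zero_mem_noise₂ hδ, by simp⟩)
    (fun ε => (continuous_timeProblem e 0 (continuous_tentSum ε)).measurable) fun ω => ?_
  -- `U` depends on `ω` but not on `ε`, so the flip on `U` is one bijection of the whole family of
  -- problems.
  obtain ⟨U, hUcard, hU⟩ := exists_unsampled (a := a) (w := w) (N := 2 * n)
    (Sum.elim (fun j => (A.t j : ℝ)) fun j => (A.θ j ω : ℝ))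
  have hUn : n ≤ U.card := by
    rw [Fintype.card_sum, Fintype.card_fin] at hUcard
    have : 2 * A.i ≤ n := hA
    omega
  have hout : ∀ ε, A.output (q ε) ω = A.output (q (flipOn U ε)) ω := fun ε => by
    refine A.output_congr rfl (fun j y => ?_) fun j y => ?_
    · exact congrArg (· • e)
        (tentSum_flipOn (fun k hk => by simpa using hU k hk (Sum.inl j)) ε).symm
    · exact congrArg (· • e)
        (tentSum_flipOn (fun k hk => by simpa using hU k hk (Sum.inr j)) ε).symm
  have hdiff : ∀ ε, ∑ k, sign (ε k) * x k - ∑ k, sign (flipOn U ε k) * x k =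
      2 * ∑ k ∈ U, sign (ε k) * x k := fun ε => by
    rw [← Finset.sum_sub_distrib, Finset.mul_sum,
      ← Finset.sum_subset (Finset.subset_univ U) fun k _ hk => by simp [flipOn_apply, hk]]
    refine Finset.sum_congr rfl fun k hk => ?_
    rw [flipOn_apply, if_pos hk, sign_not]
    ring
  have hpair : ∀ ε, 2 * ENNReal.ofReal ((∑ k ∈ U, sign (ε k) * x k) ^ 2) ≤
      A.pathError (q ε) (q ε) ω ^ (2 : ℝ) +
        A.pathError (q (flipOn U ε)) (q (flipOn U ε)) ω ^ (2 : ℝ) := fun ε => by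
    have h := A.enorm_sub_le_pathError_add hab.le (q := q ε) (q' := q (flipOn U ε)) (hout ε)
    rw [hval, hval, ← sub_smul, hdiff, enorm_smul, ← ofReal_norm (x := e), he, ENNReal.ofReal_one,
      mul_one, Real.enorm_eq_ofReal_abs, abs_mul, ENNReal.ofReal_mul (abs_nonneg _), abs_two,
      ENNReal.ofReal_ofNat] at h
    have h' := two_mul_rpow_two_le_of_two_mul_le_add h
    rwa [ENNReal.ofReal_rpow_of_nonneg (abs_nonneg _) zero_le_two, Real.rpow_two, sq_abs] at h'
  -- Summing over all `ε` counts every problem twice, once as itself and once as a flip.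
  have hsum : 2 * ∑ ε : Fin (2 * n) → Bool, ENNReal.ofReal ((∑ k ∈ U, sign (ε k) * x k) ^ 2) ≤
      2 * ∑ ε, A.pathError (q ε) (q ε) ω ^ (2 : ℝ) := by
    rw [Finset.mul_sum]
    refine (Finset.sum_le_sum fun ε _ => hpair ε).trans (le_of_eq ?_)
    rw [Finset.sum_add_distrib,
      Equiv.sum_comp (flipOn U) fun ε => A.pathError (q ε) (q ε) ω ^ (2 : ℝ), ← two_mul]
  refine le_trans ?_ ((ENNReal.mul_le_mul_iff_right (by simp) (by simp)).1 hsum)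
  rw [← ENNReal.ofReal_sum_of_nonneg fun ε _ => sq_nonneg _, sum_sq_sum_sign,
    ENNReal.ofReal_rpow_of_nonneg (by positivity) zero_le_two, Fintype.card_fun, Fintype.card_bool,
    ← ENNReal.ofReal_natCast, ← ENNReal.ofReal_mul (by positivity), Real.rpow_two, mul_pow,
    Real.sq_sqrt hn'.le]
  refine ENNReal.ofReal_le_ofReal ?_
  push_cast
  refine mul_le_mul_of_nonneg_left ?_ (by positivity)
  calc (n : ℝ) * v ^ 2 ≤ U.card * v ^ 2 := by gcongr
    _ = ∑ _k ∈ U, v ^ 2 := by rw [Finset.sum_const, nsmul_eq_mul]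
    _ ≤ ∑ k ∈ U, x k ^ 2 := Finset.sum_le_sum fun k _ => pow_le_pow_left₀ hv (hx k) 2

theorem exists_ofReal_rpow_le_minimalError (hab : a < b) (hd : 1 ≤ d) (hK : 0 < K) (hL : 0 < L)
    (hϱ₀ : 0 ≤ ϱ) (hϱ₁ : ϱ ≤ 1) {p : ℝ} (hp : 2 ≤ p) :
    ∃ C > (0 : ℝ), ∀ (Ω : Type*) [MeasurableSpace Ω] (P : Measure Ω) [IsProbabilityMeasure P]
      (n : ℕ), 0 < n → ∀ δ : ℝ, 0 ≤ δ →
      ENNReal.ofReal (C * (n : ℝ) ^ (-(ϱ + 1 / 2))) ≤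
        minimalError P p n (problemClass a b d ϱ K L ⊤) (noise₂ a b d) δ := by
  have hba : 0 < b - a := sub_pos.2 hab
  -- The first bound gives the Hölder constant `2c ≤ L`; the second gives the growth bound, since `w
  -- ≤ b - a`.
  set c := min (L / 2) (K / (b - a) ^ ϱ)
  have hc : 0 < c := by positivity
  refine ⟨c / 8 * ((b - a) / 2) ^ (ϱ + 1), by positivity, fun Ω _ P _ n hn δ hδ => ?_⟩
  have hn' : (0 : ℝ) < n := by exact_mod_cast hn
  have hn1 : (1 : ℝ) ≤ n := by exact_mod_cast hn
  have hw : 0 < (b - a) / (2 * n) := by positivity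
  have hwle : (b - a) / (2 * n) ≤ b - a := div_le_self hba.le (by linarith)
  have hcK : c * ((b - a) / (2 * n)) ^ ϱ ≤ K :=
    calc c * ((b - a) / (2 * n)) ^ ϱ ≤ K / (b - a) ^ ϱ * (b - a) ^ ϱ := by
          gcongr
          exact min_le_right _ _
      _ = K := div_mul_cancel₀ _ (by positivity)
  refine le_trans (ENNReal.ofReal_le_ofReal (le_of_eq ?_))
    (ofReal_sqrt_mul_le_minimalError hab hd hK hL hϱ₀ hϱ₁ hp (P := P) hn hδ hc
      (by linarith [min_le_left (L / 2) (K / (b - a) ^ ϱ)]) rfl hcK)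
  have h1 : ((b - a) / (2 * n)) ^ (ϱ - 1) * ((b - a) / (2 * n)) ^ 2 =
      ((b - a) / 2) ^ (ϱ + 1) * (n : ℝ) ^ (-(ϱ + 1)) := by
    rw [← Real.rpow_two, ← Real.rpow_add hw, show ϱ - 1 + 2 = ϱ + 1 by ring, ← div_div,
      Real.div_rpow (by positivity) hn'.le, Real.rpow_neg hn'.le, div_eq_mul_inv]
  have h2 : (n : ℝ) ^ (-(ϱ + 1 / 2)) = √n * (n : ℝ) ^ (-(ϱ + 1)) := by
    rw [Real.sqrt_eq_rpow, ← Real.rpow_add hn']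
    congr 1
    ring
  rw [h2]
  linear_combination (-c / 8 * √n) * h1

end

/-! ### A maximal inequality for sums of independent bounded random variables -/

section MaximalInequality

variable {Ω : Type*} [MeasurableSpace Ω] {P : Measure Ω}

/-- The martingale argument uses sequences indexed by `ℕ`, while the uniform variables come in
finite families. Padding with a constant is harmless: an event of a padded index is everything or
empty. -/
lemma iIndepFun_extend_const {β : Type*} [MeasurableSpace β] {n : ℕ}
    [IsProbabilityMeasure P] {X : Fin n → Ω → β} (hX : iIndepFun X P) (y : β) :
    iIndepFun (fun (j : ℕ) ω => if h : j < n then X ⟨j, h⟩ ω else y) P := by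
  rw [iIndepFun_iff_measure_inter_preimage_eq_mul] at hX ⊢
  intro S s hs
  by_cases h0 : ∀ j ∈ S, n ≤ j → y ∈ s j
  · set T : Finset (Fin n) := Finset.univ.filter fun k => (k : ℕ) ∈ S
    have hpre : ∀ k : Fin n, (fun ω => if h : (k : ℕ) < n then X ⟨k, h⟩ ω else y) = X k :=
      fun k => by simp
    have hinter : (⋂ j ∈ S, (fun ω => if h : j < n then X ⟨j, h⟩ ω else y) ⁻¹' s j) =
        ⋂ k ∈ T, X k ⁻¹' s k := by
      ext ω
      simp only [mem_iInter, mem_preimage, T, Finset.mem_filter, Finset.mem_univ, true_and]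
      constructor
      · intro h k hk
        simpa using h k hk
      · intro h j hj
        split_ifs with hjn
        · exact h ⟨j, hjn⟩ hj
        · exact h0 j hj (not_lt.1 hjn)
    rw [hinter, hX T fun k hk => hs k (Finset.mem_filter.1 hk).2]
    have hmap : ∏ k ∈ T, P (X k ⁻¹' s k) = ∏ j ∈ T.map Fin.valEmbedding,
        P ((fun ω => if h : j < n then X ⟨j, h⟩ ω else y) ⁻¹' s j) := by
      rw [Finset.prod_map]
      refine Finset.prod_congr rfl fun k _ => ?_
      rw [Fin.valEmbedding_apply, hpre]
    rw [hmap]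
    refine Finset.prod_subset (fun j hj => ?_) fun j hj hjT => ?_
    · obtain ⟨k, hk, rfl⟩ := Finset.mem_map.1 hj
      exact (Finset.mem_filter.1 hk).2
    · have hjn : ¬ j < n := fun h => hjT
        (Finset.mem_map.2 ⟨⟨j, h⟩, Finset.mem_filter.2 ⟨Finset.mem_univ _, hj⟩, rfl⟩)
      simp only [hjn, dif_neg, not_false_iff]
      rw [preimage_const_of_mem (h0 j hj (not_lt.1 hjn)), measure_univ]
  · push Not at h0
    obtain ⟨j, hj, hjn, hy⟩ := h0
    have hempty : (fun ω => if h : j < n then X ⟨j, h⟩ ω else y) ⁻¹' s j = ∅ := by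
      simp only [not_lt.2 hjn, dif_neg, not_false_iff]
      exact preimage_const_of_notMem hy
    rw [Finset.prod_eq_zero hj (by rw [hempty, measure_empty])]
    refine measure_mono_null (biInter_subset_of_mem hj) ?_
    rw [hempty, measure_empty]

lemma exists_uniform_sequence [IsProbabilityMeasure P] (hP : CarriesUniforms P) (n : ℕ) :
    ∃ τ : ℕ → Ω → ℝ, (∀ j, Measurable (τ j)) ∧
      (∀ j < n, P.map (τ j) = volume.restrict (Ioo 0 1)) ∧ iIndepFun τ P := by
  obtain ⟨τ, hm, hu, hi⟩ := hP n
  refine ⟨_, fun j => ?_, fun j hj => ?_, iIndepFun_extend_const hi 0⟩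
  · by_cases hj : j < n
    · simpa [hj] using hm ⟨j, hj⟩
    · simp [hj]
  · simpa [hj] using hu ⟨j, hj⟩

/-- By independence the conditional expectation of the new factor `exp (l X_{k+1})` is its mean,
which is at least `1` because `1 + x ≤ exp x` and `X_{k+1}` is centred. The sum at time `k` includes
the term `k`, as the natural filtration does. -/
lemma submartingale_exp_sum [IsProbabilityMeasure P] {X : ℕ → Ω → ℝ}
    (hm : ∀ j, Measurable (X j)) (hi : iIndepFun X P) {c : ℝ} (hc : ∀ j ω, |X j ω| ≤ c)
    (h0 : ∀ j, ∫ ω, X j ω ∂P = 0) (l : ℝ) :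
    Submartingale (fun k ω => Real.exp (l * ∑ j ∈ Finset.range (k + 1), X j ω))
      (Filtration.natural X fun j => (hm j).stronglyMeasurable) P := by
  set ℱ := Filtration.natural X fun j => (hm j).stronglyMeasurable
  have hint1 : ∀ j, Integrable (X j) P := fun j =>
    Integrable.of_bound (hm j).aestronglyMeasurable c
      (ae_of_all _ fun ω => by simpa using hc j ω)
  have hadX : ∀ {j k : ℕ}, j ≤ k → Measurable[ℱ k] (X j) := fun {j k} hjk =>
    ((Filtration.stronglyAdapted_natural fun j => (hm j).stronglyMeasurable) j).measurable.mono
      (ℱ.mono hjk) le_rfl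
  have had : ∀ k, Measurable[ℱ k]
      fun ω => Real.exp (l * ∑ j ∈ Finset.range (k + 1), X j ω) := fun k =>
    Real.measurable_exp.comp ((Finset.measurable_fun_sum _ fun j hj =>
      hadX (Finset.mem_range_succ_iff.1 hj)).const_mul l)
  have hintS : ∀ S : Finset ℕ, Integrable (fun ω => Real.exp (l * ∑ j ∈ S, X j ω)) P := by
    intro S
    refine Integrable.of_bound (Real.measurable_exp.comp
      ((Finset.measurable_fun_sum _ fun j _ => hm j).const_mul l)).aestronglyMeasurable
      (Real.exp (|l| * (S.card * c))) (ae_of_all _ fun ω => ?_)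
    rw [Real.norm_of_nonneg (Real.exp_nonneg _)]
    refine Real.exp_le_exp.2 ((le_abs_self _).trans ?_)
    rw [abs_mul]
    refine mul_le_mul_of_nonneg_left ?_ (abs_nonneg l)
    refine (Finset.abs_sum_le_sum_abs _ _).trans ?_
    refine (Finset.sum_le_card_nsmul _ _ c fun j _ => hc j ω).trans ?_
    rw [nsmul_eq_mul]
  refine submartingale_nat (fun k => (had k).stronglyMeasurable) (fun k => hintS _) fun k => ?_
  have hZ : Integrable (fun ω => Real.exp (l * X (k + 1) ω)) P := by
    simpa using hintS {k + 1}
  have hmul : (fun ω => Real.exp (l * ∑ j ∈ Finset.range (k + 1 + 1), X j ω)) =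
      (fun ω => Real.exp (l * ∑ j ∈ Finset.range (k + 1), X j ω)) *
        fun ω => Real.exp (l * X (k + 1) ω) := by
    funext ω
    rw [Finset.sum_range_succ, mul_add, Real.exp_add]
    rfl
  have h1 : P[fun ω => Real.exp (l * X (k + 1) ω) | ℱ k] =ᵐ[P]
      fun _ => P[fun ω => Real.exp (l * X (k + 1) ω)] := by
    refine condExp_indep_eq (hm (k + 1)).comap_le (ℱ.le k) ?_
      (hi.indep_comap_natural_of_lt (fun j => (hm j).stronglyMeasurable) (Nat.lt_succ_self k))
    exact (Real.measurable_exp.comp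
      ((comap_measurable (X (k + 1))).const_mul l)).stronglyMeasurable
  have h2 : 1 ≤ P[fun ω => Real.exp (l * X (k + 1) ω)] := by
    have : ∫ ω, (l * X (k + 1) ω + 1) ∂P = 1 := by
      rw [integral_add ((hint1 _).const_mul l) (integrable_const _), integral_const_mul, h0]
      simp
    rw [← this]
    exact integral_mono (((hint1 _).const_mul l).add (integrable_const _)) hZ
      fun ω => Real.add_one_le_exp _
  have h3 := condExp_mul_of_stronglyMeasurable_left (had k).stronglyMeasurable
    (hmul ▸ hintS (Finset.range (k + 1 + 1))) hZ
  rw [hmul]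
  filter_upwards [h1, h3] with ω hω1 hω3
  rw [hω3, Pi.mul_apply, hω1]
  exact le_mul_of_one_le_right (Real.exp_nonneg _) h2

/-- Doob's maximal inequality for `exp (l S_k)` with `l = 1/(c√n)`; Hoeffding's lemma bounds the
final expectation by `exp (l² n c² / 2) = exp (1/2)`. Without optimizing `l` the tail is exponential
instead of Gaussian, which suffices for all moments. -/
theorem measure_exists_le_sum_le [IsProbabilityMeasure P] {X : ℕ → Ω → ℝ}
    (hm : ∀ j, Measurable (X j)) (hi : iIndepFun X P) {c : ℝ} (hc₀ : 0 < c)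
    (hc : ∀ j ω, |X j ω| ≤ c) (h0 : ∀ j, ∫ ω, X j ω ∂P = 0) {n : ℕ} (hn : 0 < n) {x : ℝ}
    (hx : 0 ≤ x) :
    P {ω | ∃ k ≤ n, x * (c * √n) ≤ ∑ j ∈ Finset.range k, X j ω} ≤
      ENNReal.ofReal (Real.exp (1 / 2) * Real.exp (-x)) := by
  -- For `x = 0` the empty sum reaches the threshold and the bound exceeds `1`; for `x > 0` the case
  -- `k = 0` cannot occur.
  rcases hx.eq_or_lt with rfl | hx
  · refine prob_le_one.trans ?_
    rw [← ENNReal.ofReal_one]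
    exact ENNReal.ofReal_le_ofReal (by simp [Real.one_le_exp_iff])
  obtain ⟨n, rfl⟩ := Nat.exists_eq_succ_of_ne_zero hn.ne'
  have hs : 0 < c * √(n + 1 : ℕ) := by positivity
  set l := (c * √(n + 1 : ℕ))⁻¹
  have hl : 0 < l := inv_pos.2 hs
  have hsub := submartingale_exp_sum hm hi hc h0 l
  have hmax := maximal_ineq hsub (fun k ω => Real.exp_nonneg _)
    (ε := ⟨Real.exp x, Real.exp_nonneg _⟩) n
  have hsg : HasSubgaussianMGF (fun ω => ∑ j ∈ Finset.range (n + 1), X j ω)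
      (∑ _j ∈ Finset.range (n + 1), (‖c - -c‖₊ / 2) ^ 2) P :=
    HasSubgaussianMGF.sum_of_iIndepFun hi fun j _ =>
      hasSubgaussianMGF_of_mem_Icc_of_integral_eq_zero (hm j).aemeasurable
        (ae_of_all _ fun ω => abs_le.1 (hc j ω)) (h0 j)
  have hmgf : ∫ ω, Real.exp (l * ∑ j ∈ Finset.range (n + 1), X j ω) ∂P ≤ Real.exp (1 / 2) := by
    refine (hsg.mgf_le l).trans (Real.exp_le_exp.2 (le_of_eq ?_))
    have h2 : ‖c - -c‖ / 2 = c := by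
      rw [sub_neg_eq_add, Real.norm_of_nonneg (by linarith)]
      ring
    have h3 : √((n : ℝ) + 1) ^ 2 = n + 1 := Real.sq_sqrt (by positivity)
    rw [Finset.sum_const, Finset.card_range, NNReal.coe_nsmul, NNReal.coe_pow, NNReal.coe_div,
      coe_nnnorm, NNReal.coe_ofNat, h2, nsmul_eq_mul]
    simp only [l]
    push_cast
    rw [inv_pow, mul_pow, h3]
    field_simp
  have hsubset : {ω | ∃ k ≤ n + 1, x * (c * √(n + 1 : ℕ)) ≤ ∑ j ∈ Finset.range k, X j ω} ⊆
      {ω | ((⟨Real.exp x, Real.exp_nonneg _⟩ : NNReal) : ℝ) ≤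
        (Finset.range (n + 1)).sup' Finset.nonempty_range_add_one fun k =>
          Real.exp (l * ∑ j ∈ Finset.range (k + 1), X j ω)} := by
    rintro ω ⟨k, hk, hkx⟩
    cases k with
    | zero => exact absurd hkx (by simpa using mul_pos hx hs)
    | succ k =>
      rw [mem_ofPred_eq]
      refine le_trans ?_ (Finset.le_sup' _ (Finset.mem_range.2 hk))
      refine Real.exp_le_exp.2 ?_
      rw [← div_eq_inv_mul, le_div_iff₀ hs]
      exact hkx
  have h4 : ENNReal.ofReal (Real.exp x) *
      P {ω | ∃ k ≤ n + 1, x * (c * √(n + 1 : ℕ)) ≤ ∑ j ∈ Finset.range k, X j ω} ≤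
        ENNReal.ofReal (Real.exp (1 / 2)) := by
    refine (mul_le_mul' (le_of_eq ?_) (measure_mono hsubset)).trans
      (hmax.trans (ENNReal.ofReal_le_ofReal (le_trans ?_ hmgf)))
    · rw [ENNReal.ofReal, Real.toNNReal_of_nonneg (Real.exp_nonneg x)]
      rfl
    · exact setIntegral_le_integral (hsub.integrable n) (ae_of_all _ fun ω => Real.exp_nonneg _)
  rw [Real.exp_neg, ← div_eq_mul_inv, ENNReal.ofReal_div_of_pos (Real.exp_pos x)]
  rw [ENNReal.le_div_iff_mul_le (Or.inl (by simp [Real.exp_pos])) (Or.inl ENNReal.ofReal_ne_top),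
    mul_comm]
  exact h4

end MaximalInequality

/-! ### Moments of the maximal partial sum -/

section Moments

variable {Ω : Type*} [MeasurableSpace Ω] {P : Measure Ω}

lemma summable_add_one_pow_mul_exp_neg (k : ℕ) :
    Summable fun m : ℕ => ((m : ℝ) + 1) ^ k * Real.exp (-m) := by
  have h := (summable_nat_add_iff 1).2 (Real.summable_pow_mul_exp_neg_nat_mul k one_pos)
  refine (h.mul_left (Real.exp 1)).congr fun m => ?_
  push_cast
  rw [mul_left_comm, ← Real.exp_add]
  congr 2
  ring

lemma lintegral_rpow_le_of_exp_tail {W : Ω → ℝ} (hW : Measurable W) (hW₀ : ∀ ω, 0 ≤ W ω) {B : ℝ}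
    (hB : 0 ≤ B) (htail : ∀ m : ℕ, P {ω | (m : ℝ) ≤ W ω} ≤ ENNReal.ofReal (B * Real.exp (-m)))
    {p : ℝ} (hp : 0 ≤ p) :
    ∫⁻ ω, ENNReal.ofReal (W ω) ^ p ∂P ≤
      ENNReal.ofReal (B * ∑' m : ℕ, ((m : ℝ) + 1) ^ ⌈p⌉₊ * Real.exp (-m)) := by
  have hset : ∀ m : ℕ, MeasurableSet {ω | (m : ℝ) ≤ W ω} := fun m =>
    measurableSet_le measurable_const hW
  have hpt : ∀ ω, ENNReal.ofReal (W ω) ^ p ≤ ∑' m : ℕ,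
      {ω | (m : ℝ) ≤ W ω}.indicator (fun _ => ENNReal.ofReal (((m : ℝ) + 1) ^ ⌈p⌉₊)) ω := by
    intro ω
    -- The single term at `m = ⌊W ω⌋₊` already dominates, as `W ω < m + 1`.
    refine le_trans ?_ (ENNReal.le_tsum ⌊W ω⌋₊)
    rw [indicator_of_mem (show ω ∈ {ω' | (⌊W ω⌋₊ : ℝ) ≤ W ω'} from Nat.floor_le (hW₀ ω)),
      ENNReal.ofReal_rpow_of_nonneg (hW₀ ω) hp]
    refine ENNReal.ofReal_le_ofReal ?_
    calc W ω ^ p ≤ ((⌊W ω⌋₊ : ℝ) + 1) ^ p :=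
          Real.rpow_le_rpow (hW₀ ω) (Nat.lt_floor_add_one _).le hp
      _ ≤ ((⌊W ω⌋₊ : ℝ) + 1) ^ (⌈p⌉₊ : ℝ) :=
          Real.rpow_le_rpow_of_exponent_le (by linarith [Nat.cast_nonneg (α := ℝ) ⌊W ω⌋₊])
            (Nat.le_ceil p)
      _ = _ := Real.rpow_natCast _ _
  calc ∫⁻ ω, ENNReal.ofReal (W ω) ^ p ∂P
      ≤ ∫⁻ ω, ∑' m : ℕ, {ω | (m : ℝ) ≤ W ω}.indicator
          (fun _ => ENNReal.ofReal (((m : ℝ) + 1) ^ ⌈p⌉₊)) ω ∂P := lintegral_mono hpt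
    _ = ∑' m : ℕ, ENNReal.ofReal (((m : ℝ) + 1) ^ ⌈p⌉₊) * P {ω | (m : ℝ) ≤ W ω} := by
        rw [lintegral_tsum fun m => (measurable_const.indicator (hset m)).aemeasurable]
        refine tsum_congr fun m => ?_
        rw [lintegral_indicator_const (hset m)]
    _ ≤ ∑' m : ℕ, ENNReal.ofReal (B * (((m : ℝ) + 1) ^ ⌈p⌉₊ * Real.exp (-m))) := by
        refine ENNReal.tsum_le_tsum fun m => ?_
        refine (mul_le_mul_right (htail m) _).trans (le_of_eq ?_)
        rw [← ENNReal.ofReal_mul (by positivity)]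
        congr 1
        ring
    _ = _ := by
        rw [← tsum_mul_left, ENNReal.ofReal_tsum_of_nonneg (fun m => by positivity)
          ((summable_add_one_pow_mul_exp_neg _).mul_left B)]

variable {d : ℕ}

/-- The maximal norm of the partial sums of at most `n` terms. -/
noncomputable def maxPartialSum {E : Type*} [SeminormedAddCommGroup E] (n : ℕ) (D : ℕ → E) : ℝ :=
  (Finset.range (n + 1)).sup' Finset.nonempty_range_add_one
    fun k => ‖∑ j ∈ Finset.range k, D j‖

lemma norm_sum_le_maxPartialSum {E : Type*} [SeminormedAddCommGroup E] {n k : ℕ} (hk : k ≤ n)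
    (D : ℕ → E) : ‖∑ j ∈ Finset.range k, D j‖ ≤ maxPartialSum n D :=
  Finset.le_sup' (fun k => ‖∑ j ∈ Finset.range k, D j‖) (Finset.mem_range_succ_iff.2 hk)

lemma maxPartialSum_nonneg {E : Type*} [SeminormedAddCommGroup E] (n : ℕ) (D : ℕ → E) :
    0 ≤ maxPartialSum n D :=
  (norm_nonneg _).trans (norm_sum_le_maxPartialSum (Nat.zero_le n) D)

lemma measurable_maxPartialSum {D : ℕ → Ω → Vec d} (hD : ∀ j, Measurable (D j)) (n : ℕ) :
    Measurable fun ω => maxPartialSum n fun j => D j ω := by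
  have := Finset.measurable_sup' (s := Finset.range (n + 1)) Finset.nonempty_range_add_one
    (f := fun k ω => ‖∑ j ∈ Finset.range k, D j ω‖)
    fun k _ => (Finset.measurable_fun_sum _ fun j _ => hD j).norm
  convert this using 1
  funext ω
  rw [Finset.sup'_apply]
  rfl

lemma Vec.measurable_apply (i : Fin d) : Measurable fun x : Vec d => x i :=
  (PiLp.continuous_apply 1 _ i).measurable

lemma Vec.sum_apply {ι : Type*} (s : Finset ι) (D : ι → Vec d) (i : Fin d) :
    (∑ j ∈ s, D j) i = ∑ j ∈ s, D j i := by
  simp [WithLp.ofLp_sum]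

/-- If the `ℓ¹` norm is at least `d·y`, some coordinate is at least `y` in absolute value. A union
bound over `d` coordinates and two signs reduces the claim to the one-sided scalar estimate. -/
theorem measure_le_maxPartialSum_le [IsProbabilityMeasure P] {D : ℕ → Ω → Vec d}
    (hm : ∀ j, Measurable (D j)) (hi : iIndepFun D P) {c : ℝ} (hc₀ : 0 < c)
    (hc : ∀ j ω i, |D j ω i| ≤ c) (h0 : ∀ j i, ∫ ω, D j ω i ∂P = 0) (hd : 1 ≤ d) {n : ℕ}
    (hn : 0 < n) {x : ℝ} (hx : 0 ≤ x) :
    P {ω | x ≤ (maxPartialSum n fun j => D j ω) / (d * (c * √n))} ≤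
      ENNReal.ofReal (2 * d * Real.exp (1 / 2) * Real.exp (-x)) := by
  have hs : 0 < c * √n := by positivity
  have hd' : (0 : ℝ) < d := by exact_mod_cast hd
  set E : Fin d × Bool → Set Ω := fun i =>
    {ω | ∃ k ≤ n, x * (c * √n) ≤ ∑ j ∈ Finset.range k, sign i.2 * D j ω i.1}
  have hE : ∀ i, P (E i) ≤ ENNReal.ofReal (Real.exp (1 / 2) * Real.exp (-x)) := fun i => by
    have hg : Measurable fun y : Vec d => sign i.2 * y i.1 :=
      (Vec.measurable_apply i.1).const_mul _
    refine measure_exists_le_sum_le (fun j => hg.comp (hm j)) (hi.comp _ fun _ => hg) hc₀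
      (fun j ω => ?_) (fun j => ?_) hn hx
    · simpa [abs_mul, abs_sign] using hc j ω i.1
    · simp only [Function.comp_def]
      rw [integral_const_mul, h0, mul_zero]
  have hsub : {ω | x ≤ (maxPartialSum n fun j => D j ω) / (d * (c * √n))} ⊆ ⋃ i, E i := by
    intro ω hω
    rw [mem_ofPred_eq, le_div_iff₀ (by positivity)] at hω
    obtain ⟨k, hk, hk'⟩ := Finset.exists_mem_eq_sup' (s := Finset.range (n + 1))
      Finset.nonempty_range_add_one fun k => ‖∑ j ∈ Finset.range k, D j ω‖
    rw [maxPartialSum, hk', PiLp.norm_eq_of_L1] at hω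
    have hle : ∑ _i : Fin d, x * (c * √n) ≤ ∑ i, ‖(∑ j ∈ Finset.range k, D j ω) i‖ := by
      refine le_trans (le_of_eq ?_) hω
      rw [Finset.sum_const, Finset.card_univ, Fintype.card_fin, nsmul_eq_mul]
      ring
    obtain ⟨i, -, hik⟩ := Finset.exists_le_of_sum_le ⟨⟨0, hd⟩, Finset.mem_univ _⟩ hle
    rw [Vec.sum_apply, Real.norm_eq_abs] at hik
    rw [mem_iUnion]
    rcases le_abs.1 hik with h | h
    · exact ⟨(i, true), k, Finset.mem_range_succ_iff.1 hk, by simpa [sign] using h⟩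
    · exact ⟨(i, false), k, Finset.mem_range_succ_iff.1 hk, by simpa [sign] using h⟩
  calc P {ω | x ≤ (maxPartialSum n fun j => D j ω) / (d * (c * √n))}
      ≤ ∑ i, P (E i) := (measure_mono hsub).trans (measure_iUnion_fintype_le _ _)
    _ ≤ ∑ _i : Fin d × Bool, ENNReal.ofReal (Real.exp (1 / 2) * Real.exp (-x)) :=
        Finset.sum_le_sum fun i _ => hE i
    _ = _ := by
        rw [Finset.sum_const, Finset.card_univ, Fintype.card_prod, Fintype.card_fin,
          Fintype.card_bool, nsmul_eq_mul, ← ENNReal.ofReal_natCast,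
          ← ENNReal.ofReal_mul (by positivity)]
        congr 1
        push_cast
        ring

/-- After division by `d c √n` the tail bound no longer involves `c` or `n`, so `A` depends only on
`d` and `p`. -/
theorem exists_lintegral_maxPartialSum_le (hd : 1 ≤ d) {p : ℝ} (hp : 0 < p) :
    ∃ A > (0 : ℝ), ∀ (Ω : Type*) [MeasurableSpace Ω] (P : Measure Ω) [IsProbabilityMeasure P]
      (D : ℕ → Ω → Vec d) (c : ℝ) (n : ℕ), (∀ j, Measurable (D j)) → iIndepFun D P → 0 < c →
      (∀ j ω i, |D j ω i| ≤ c) → (∀ j i, ∫ ω, D j ω i ∂P = 0) → 0 < n →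
      (∫⁻ ω, ENNReal.ofReal (maxPartialSum n fun j => D j ω) ^ p ∂P) ^ (1 / p) ≤
        ENNReal.ofReal (A * (c * √n)) := by
  have hd' : (0 : ℝ) < d := by exact_mod_cast hd
  set T := 2 * d * Real.exp (1 / 2) * ∑' m : ℕ, ((m : ℝ) + 1) ^ ⌈p⌉₊ * Real.exp (-m)
  have hT : 0 < T := by
    have := (summable_add_one_pow_mul_exp_neg ⌈p⌉₊).tsum_pos (fun m => by positivity) 0
      (by positivity)
    positivity
  refine ⟨d * T ^ (1 / p), by positivity, fun Ω _ P _ D c n hm hi hc₀ hc h0 hn => ?_⟩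
  have hs : 0 < d * (c * √n) := by positivity
  have h := lintegral_rpow_le_of_exp_tail (P := P)
    (W := fun ω => (maxPartialSum n fun j => D j ω) / (d * (c * √n)))
    ((measurable_maxPartialSum hm n).div_const _)
    (fun ω => div_nonneg (maxPartialSum_nonneg _ _) hs.le)
    (B := 2 * d * Real.exp (1 / 2)) (by positivity)
    (fun m => measure_le_maxPartialSum_le hm hi hc₀ hc h0 hd hn (Nat.cast_nonneg m)) hp.le
  have h1 : ∀ ω, ENNReal.ofReal (maxPartialSum n fun j => D j ω) ^ p =
      ENNReal.ofReal (d * (c * √n)) ^ p *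
        ENNReal.ofReal ((maxPartialSum n fun j => D j ω) / (d * (c * √n))) ^ p := fun ω => by
    rw [← ENNReal.mul_rpow_of_nonneg _ _ hp.le, ← ENNReal.ofReal_mul hs.le,
      mul_div_cancel₀ _ hs.ne']
  simp_rw [h1]
  rw [lintegral_const_mul _ (((measurable_maxPartialSum hm n).div_const _).ennreal_ofReal.pow_const
    _), ENNReal.mul_rpow_of_nonneg _ _ (by positivity), ← ENNReal.rpow_mul,
    mul_one_div_cancel hp.ne', ENNReal.rpow_one]
  refine (mul_le_mul_right (ENNReal.rpow_le_rpow h (by positivity)) _).trans (le_of_eq ?_)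
  rw [ENNReal.ofReal_rpow_of_pos hT, ← ENNReal.ofReal_mul hs.le]
  congr 1
  ring

end Moments

/-! ### The randomized Euler scheme -/

section Scheme

variable {a b : ℝ} {d : ℕ}

/-- The Euler polygon with step size `h` that is determined by the slopes `I.2.1` and the initial
value `I.2.2`. -/
noncomputable def eulerPath (a h : ℝ) {n : ℕ} (I : Info d n) (t : ℝ) : Vec d :=
  I.2.2 + ∑ k : Fin n, max 0 (min h (t - (a + (k : ℕ) * h))) • I.2.1 k

lemma continuous_eulerPath (a h : ℝ) {n : ℕ} (I : Info d n) : Continuous (eulerPath a h I) := by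
  unfold eulerPath
  fun_prop

/-- The Euler polygon as an element of the Skorokhod space. -/
noncomputable def eulerOutput (a b h : ℝ) {n : ℕ} (I : Info d n) : Skorokhod a b d where
  toFun t := eulerPath a h I t
  rightCont _ := ((continuous_eulerPath a h I).comp continuous_subtype_val).continuousWithinAt
  leftLim t := ⟨_, (((continuous_eulerPath a h I).comp
    continuous_subtype_val).tendsto t).mono_left nhdsWithin_le_nhds⟩

/-- The identity time change bounds the Skorokhod distance by the uniform one, and every slope
enters with a weight in `[0,h]`. -/
lemma continuous_eulerOutput {h : ℝ} (hh : 0 ≤ h) (n : ℕ) :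
    Continuous (eulerOutput a b h : Info d n → Skorokhod a b d) := by
  refine continuous_iff_continuousAt.2 fun I₀ => ?_
  rw [ContinuousAt, tendsto_iff_edist_tendsto_0]
  have hlim : Tendsto (fun I : Info d n =>
      ENNReal.ofReal (‖I.2.2 - I₀.2.2‖ + ∑ k, h * ‖I.2.1 k - I₀.2.1 k‖)) (𝓝 I₀) (𝓝 0) := by
    have hc : Continuous fun I : Info d n =>
        ENNReal.ofReal (‖I.2.2 - I₀.2.2‖ + ∑ k, h * ‖I.2.1 k - I₀.2.1 k‖) :=
      ENNReal.continuous_ofReal.comp (by fun_prop)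
    simpa using hc.tendsto I₀
  refine tendsto_of_tendsto_of_tendsto_of_le_of_le tendsto_const_nhds hlim
    (fun _ => zero_le) fun I => ?_
  refine iInf_le_of_le (OrderIso.refl _) (max_le (by simp) (iSup_le fun t => ?_))
  rw [edist_dist, dist_eq_norm]
  refine ENNReal.ofReal_le_ofReal ?_
  simp only [eulerOutput, eulerPath, OrderIso.refl_apply]
  rw [add_sub_add_comm, ← Finset.sum_sub_distrib]
  refine (norm_add_le _ _).trans (add_le_add_right ((norm_sum_le _ _).trans
    (Finset.sum_le_sum fun k _ => ?_)) _)
  rw [← smul_sub, norm_smul, Real.norm_of_nonneg (le_max_left _ _)]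
  exact mul_le_mul_of_nonneg_right (max_le hh (min_le_left _ _)) (norm_nonneg _)

variable {Ω : Type*} [MeasurableSpace Ω]

/-- The Euler scheme with step size `h` that evaluates the right-hand side at the random times
`θ j`. -/
noncomputable def randomizedEuler (hab : a ≤ b) {h : ℝ} (hh : 0 ≤ h) (n : ℕ)
    (θ : ℕ → Ω → Icc a b) (hθ : ∀ j, Measurable (θ j)) : Algorithm Ω a b d where
  i := n
  t _ := ⟨a, left_mem_Icc.2 hab⟩
  θ j := θ j
  measurable_θ j := hθ j
  -- The second component recomputes the current Euler point from the slopes seen so far; the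
  -- evaluations at the fixed time are dummies at `(a, 0)`.
  ψ _ I := (0, I.2.2 + h • ∑ k, I.2.1 k)
  measurable_ψ j := by
    have hc : Continuous fun I : Info d j => ((0 : Vec d), I.2.2 + h • ∑ k, I.2.1 k) := by
      fun_prop
    exact hc.measurable
  φ := eulerOutput a b h
  measurable_φ := (continuous_eulerOutput hh n).measurable

/-- The points of the Euler scheme with right-hand side evaluated at the times `θ j`. -/
noncomputable def eulerPoint (r : Problem a b d) (h : ℝ) (θ : ℕ → Icc a b) : ℕ → Vec d
  | 0 => r.1
  | j + 1 => eulerPoint r h θ j + h • r.2 (θ j, eulerPoint r h θ j)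

lemma eulerPoint_eq (r : Problem a b d) (h : ℝ) (θ : ℕ → Icc a b) (j : ℕ) :
    eulerPoint r h θ j =
      r.1 + h • ∑ k ∈ Finset.range j, r.2 (θ k, eulerPoint r h θ k) := by
  induction j with
  | zero => simp [eulerPoint]
  | succ j ih =>
    rw [Finset.sum_range_succ, smul_add, ← add_assoc, ← ih]
    rfl

lemma infoUpTo_randomizedEuler (hab : a ≤ b) {h : ℝ} (hh : 0 ≤ h) (n : ℕ)
    (θ : ℕ → Ω → Icc a b) (hθ : ∀ j, Measurable (θ j)) (r : Problem a b d) (ω : Ω) :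
    ∀ (j : ℕ) (hj : j ≤ n), (randomizedEuler hab hh n θ hθ).infoUpTo r ω j hj =
      (fun _ : Fin j => r.2 (⟨a, left_mem_Icc.2 hab⟩, 0),
        fun k : Fin j => r.2 (θ k ω, eulerPoint r h (fun k => θ k ω) k), r.1)
  | 0, _ => by
    simp only [Algorithm.infoUpTo]
    refine Prod.ext (funext fun k => k.elim0) (Prod.ext (funext fun k => k.elim0) rfl)
  | j + 1, hj => by
    have ih := infoUpTo_randomizedEuler hab hh n θ hθ r ω j (Nat.le_of_succ_le hj)
    simp only [Algorithm.infoUpTo, ih]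
    refine Prod.ext (funext fun k => ?_) (Prod.ext (funext fun k => ?_) rfl)
    · refine Fin.lastCases ?_ (fun k => ?_) k
      · simp [randomizedEuler]
      · simp
    · refine Fin.lastCases ?_ (fun k => ?_) k
      · simp only [randomizedEuler, Fin.snoc_last, Fin.val_last]
        rw [eulerPoint_eq r h _ j,
          Fin.sum_univ_eq_sum_range (fun k => r.2 (θ k ω, eulerPoint r h (fun k => θ k ω) k)) j]
      · simp

lemma output_randomizedEuler (hab : a ≤ b) {h : ℝ} (hh : 0 ≤ h) (n : ℕ)
    (θ : ℕ → Ω → Icc a b) (hθ : ∀ j, Measurable (θ j)) (r : Problem a b d) (ω : Ω)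
    (t : Icc a b) : ((randomizedEuler hab hh n θ hθ).output r ω).toFun t =
      r.1 + ∑ k ∈ Finset.range n, max 0 (min h (t - (a + k * h))) •
        r.2 (θ k ω, eulerPoint r h (fun k => θ k ω) k) := by
  have := infoUpTo_randomizedEuler hab hh n θ hθ r ω n le_rfl
  have h1 : (randomizedEuler hab hh n θ hθ).output r ω = eulerOutput a b h _ :=
    congrArg (eulerOutput a b h) this
  rw [h1]
  simp only [eulerOutput, eulerPath]
  rw [Fin.sum_univ_eq_sum_range (fun k : ℕ => max 0 (min h ((t : ℝ) - (a + k * h))) •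
    r.2 (θ k ω, eulerPoint r h (fun k => θ k ω) k)) n]

/-- For `t` in the `k`-th cell the clamped weight is `h` on earlier cells, `0` on later ones and the
elapsed time on the cell itself. -/
lemma polygon_eq (r : Problem a b d) {h : ℝ} (hh : 0 ≤ h) (θ : ℕ → Icc a b) {n k : ℕ}
    (hk : k < n) {t : ℝ} (ht : a + k * h ≤ t) (ht' : t ≤ a + (k + 1) * h) :
    r.1 + ∑ j ∈ Finset.range n, max 0 (min h (t - (a + j * h))) • r.2 (θ j, eulerPoint r h θ j) =
      eulerPoint r h θ k + (t - (a + k * h)) • r.2 (θ k, eulerPoint r h θ k) := by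
  have h1 : ∀ j ∈ Finset.range n, j ∉ Finset.range (k + 1) →
      max 0 (min h (t - (a + j * h))) • r.2 (θ j, eulerPoint r h θ j) = 0 := fun j _ hj => by
    have hj' : k + 1 ≤ j := by simpa using hj
    have hj'' : ((k : ℝ) + 1) * h ≤ j * h :=
      mul_le_mul_of_nonneg_right (by exact_mod_cast hj') hh
    rw [max_eq_left (min_le_of_right_le (by linarith)), zero_smul]
  rw [← Finset.sum_subset (Finset.range_subset_range.2 hk) h1, Finset.sum_range_succ,
    eulerPoint_eq r h θ k, Finset.smul_sum, add_assoc]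
  congr 2
  · refine Finset.sum_congr rfl fun j hj => ?_
    have hj' : j + 1 ≤ k := Finset.mem_range.1 hj
    have hj'' : ((j : ℝ) + 1) * h ≤ k * h :=
      mul_le_mul_of_nonneg_right (by exact_mod_cast hj') hh
    rw [min_eq_left (by linarith), max_eq_right hh]
  · rw [min_eq_right (by linarith), max_eq_right (by linarith)]

lemma exists_cell {h : ℝ} {n : ℕ} (hn : 0 < n) (hab : a < b) (hh : h = (b - a) / n) {t : ℝ}
    (ht : t ∈ Icc a b) : ∃ k < n, a + k * h ≤ t ∧ t ≤ a + (k + 1) * h := by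
  have hn' : (0 : ℝ) < n := by exact_mod_cast hn
  have hh₀ : 0 < h := by rw [hh]; exact div_pos (sub_pos.2 hab) hn'
  have hnh : n * h = b - a := by rw [hh]; field_simp
  by_cases hk : ⌊(t - a) / h⌋₊ < n
  · refine ⟨_, hk, ?_, ?_⟩
    · have := Nat.floor_le (div_nonneg (sub_nonneg.2 ht.1) hh₀.le)
      rw [le_div_iff₀ hh₀] at this
      linarith
    · have := Nat.lt_floor_add_one ((t - a) / h)
      rw [div_lt_iff₀ hh₀] at this
      linarith
  -- Only `t = b` gets here; it is assigned to the last cell.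
  · have h1 : (n : ℝ) ≤ (t - a) / h :=
      (Nat.cast_le.2 (not_lt.1 hk)).trans
        (Nat.floor_le (div_nonneg (sub_nonneg.2 ht.1) hh₀.le))
    rw [le_div_iff₀ hh₀] at h1
    obtain ⟨m, rfl⟩ := Nat.exists_eq_succ_of_ne_zero hn.ne'
    push_cast at hnh h1
    refine ⟨m, Nat.lt_succ_self m, ?_, ?_⟩
    · linarith
    · linarith [ht.2]

end Scheme

/-! ### Regularity of the solution -/

section Regularity

variable {a b : ℝ} {d : ℕ} {ϱ K L : ℝ}

/-- The bound `(K+2)e^{(K+1)(b-a)}` for `1 + ‖x‖`, for points `x` of the solution or of the Euler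
scheme. -/
noncomputable def stateBound (a b K : ℝ) : ℝ := (K + 2) * Real.exp ((K + 1) * (b - a))

lemma stateBound_pos (hK : 0 < K) : 0 < stateBound a b K := by
  unfold stateBound
  positivity

/-- This is the role of `R₁`, which equals `stateBound a b K + K - 1`. -/
lemma edist_le_radius₀ (hab : a < b) (hK : 0 < K) {x η : Vec d} (hη : ‖η‖ ≤ K)
    (hx : 1 + ‖x‖ ≤ stateBound a b K) : edist x η ≤ ENNReal.ofReal (radius₀ a b K) := by
  rw [edist_le_ofReal_iff_norm_sub (radius₀_pos hab hK).le]
  refine (norm_sub_le _ _).trans (le_trans ?_ (le_max_left _ _))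
  unfold stateBound at hx
  linarith

lemma IsSolution.one_add_norm_le (hab : a < b) (hK : 0 < K) {R : ℝ≥0∞} {q : Problem a b d}
    (hq : q ∈ problemClass a b d ϱ K L R) {z : ℝ → Vec d} (hz : IsSolution q z) {t : ℝ}
    (ht : t ∈ Icc a b) : 1 + ‖z t‖ ≤ stateBound a b K := by
  have h1 := hz.norm_sub_initial_le hab hK hq ht
  have h2 := norm_add_le q.1 (z t - q.1)
  rw [add_sub_cancel] at h2
  have h3 : Real.exp (K * (b - a)) ≤ Real.exp ((K + 1) * (b - a)) := by
    have := sub_nonneg.2 hab.le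
    gcongr
    linarith
  have h4 := mul_le_mul_of_nonneg_left h3 (by linarith : 0 ≤ 1 + K)
  unfold stateBound
  linarith [hq.1, Real.exp_pos ((K + 1) * (b - a))]

/-- The derivative `f(t, z(t))` of the solution, extended to a continuous function on the line. -/
noncomputable def velocity (hab : a ≤ b) (q : Problem a b d) (z : ℝ → Vec d) (t : ℝ) : Vec d :=
  q.2 (projIcc a b hab t, z (projIcc a b hab t))

lemma velocity_of_mem (hab : a ≤ b) (q : Problem a b d) (z : ℝ → Vec d) (t : Icc a b) :
    velocity hab q z t = q.2 (t, z t) := by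
  simp [velocity]

lemma continuous_velocity (hab : a ≤ b) {q : Problem a b d} (hq : Continuous q.2) {z : ℝ → Vec d}
    (hz : ContinuousOn z (Icc a b)) : Continuous (velocity hab q z) :=
  hq.comp (continuous_projIcc.prodMk
    (hz.comp_continuous (continuous_subtype_val.comp continuous_projIcc) fun _ => Subtype.prop _))

lemma IsSolution.integral_velocity (hab : a ≤ b) {q : Problem a b d} (hq : Continuous q.2)
    {z : ℝ → Vec d} (hz : IsSolution q z) {s t : ℝ} (has : a ≤ s) (hst : s ≤ t) (htb : t ≤ b) :
    ∫ x in s..t, velocity hab q z x = z t - z s := by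
  refine intervalIntegral.integral_eq_sub_of_hasDerivAt_of_le hst
    (hz.continuousOn.mono (Icc_subset_Icc has htb)) (fun x hx => ?_)
    ((continuous_velocity hab hq hz.continuousOn).intervalIntegrable _ _)
  have hx' : x ∈ Ioo a b := ⟨has.trans_lt hx.1, hx.2.trans_le htb⟩
  have := (hz.2 ⟨x, Ioo_subset_Icc_self hx'⟩).hasDerivAt (Icc_mem_nhds hx'.1 hx'.2)
  rwa [← velocity_of_mem hab] at this

variable {R : ℝ≥0∞} {q : Problem a b d} {z : ℝ → Vec d}

lemma IsSolution.norm_velocity_le (hab : a < b) (hK : 0 < K)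
    (hq : q ∈ problemClass a b d ϱ K L R) (hz : IsSolution q z) (t : ℝ) :
    ‖velocity hab.le q z t‖ ≤ K * stateBound a b K :=
  (hq.2.2.1 _ _).trans
    (mul_le_mul_of_nonneg_left (hz.one_add_norm_le hab hK hq (Subtype.prop _)) hK.le)

lemma IsSolution.norm_sub_le_mul (hab : a < b) (hK : 0 < K)
    (hq : q ∈ problemClass a b d ϱ K L R) (hz : IsSolution q z) {s t : ℝ} (hs : s ∈ Icc a b)
    (ht : t ∈ Icc a b) : ‖z t - z s‖ ≤ K * stateBound a b K * |t - s| := by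
  wlog hst : s ≤ t generalizing s t
  · rw [norm_sub_rev, abs_sub_comm]
    exact this ht hs (le_of_not_ge hst)
  rw [← hz.integral_velocity hab.le hq.2.1 hs.1 hst ht.2]
  exact intervalIntegral.norm_integral_le_of_norm_le_const
    fun x _ => hz.norm_velocity_le hab hK hq x

/-- Time is changed first and the state second; the trajectory lies in the ball where `f` is Hölder
and Lipschitz, and is itself Lipschitz in time. -/
lemma IsSolution.norm_velocity_sub_le (hab : a < b) (hK : 0 < K) (hL : 0 < L)
    (hq : q ∈ problemClass a b d ϱ K L (ENNReal.ofReal (radius₀ a b K)))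
    (hz : IsSolution q z) {s t : ℝ} (hs : s ∈ Icc a b) (ht : t ∈ Icc a b) :
    ‖velocity hab.le q z t - velocity hab.le q z s‖ ≤
      L * |t - s| ^ ϱ + L * (K * stateBound a b K * |t - s|) := by
  have hball : ∀ {x}, x ∈ Icc a b → edist (z x) q.1 ≤ ENNReal.ofReal (radius₀ a b K) :=
    fun hx => edist_le_radius₀ hab hK hq.1 (hz.one_add_norm_le hab hK hq hx)
  have hv : ∀ x : Icc a b, velocity hab.le q z x = q.2 (x, z x) := velocity_of_mem hab.le q z
  have h1 := hq.2.2.2.1 ⟨t, ht⟩ ⟨s, hs⟩ (z t) (hball ht)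
  have h2 := hq.2.2.2.2 ⟨s, hs⟩ (z t) (z s) (hball ht) (hball hs)
  have h3 := mul_le_mul_of_nonneg_left (hz.norm_sub_le_mul hab hK hq hs ht) hL.le
  have h4 := norm_sub_le_norm_sub_add_norm_sub (q.2 (⟨t, ht⟩, z t)) (q.2 (⟨s, hs⟩, z t))
    (q.2 (⟨s, hs⟩, z s))
  rw [hv ⟨t, ht⟩, hv ⟨s, hs⟩]
  simp only at h1
  linarith

end Regularity

/-! ### The error of the Euler scheme -/

section ErrorBound

variable {a b : ℝ} {d : ℕ} {ϱ K L : ℝ}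

/-- Discrete Gronwall. The induction runs on the right-hand side of the hypothesis, which grows by a
factor of at most `1 + c` when it is replaced by its bound. -/
lemma le_mul_one_add_pow_of_le_add_sum {u : ℕ → ℝ} {B c : ℝ} (hc : 0 ≤ c) {n : ℕ}
    (hu : ∀ k ≤ n, u k ≤ B + c * ∑ j ∈ Finset.range k, u j) :
    ∀ k ≤ n, u k ≤ B * (1 + c) ^ k := by
  have key : ∀ k ≤ n, B + c * ∑ j ∈ Finset.range k, u j ≤ B * (1 + c) ^ k := by
    intro k
    induction k with
    | zero => simp
    | succ k ih =>
      intro hk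
      have h1 := ih (Nat.le_of_succ_le hk)
      have h2 := (hu k (Nat.le_of_succ_le hk)).trans h1
      rw [Finset.sum_range_succ, pow_succ]
      nlinarith [mul_le_mul_of_nonneg_left h2 hc]
  exact fun k hk => (hu k hk).trans (key k hk)

lemma one_add_mul_pow_le_exp {c h : ℝ} (hc : 0 ≤ c) (hh : 0 ≤ h) {k n : ℕ} (hk : k ≤ n)
    (hn : n * h = b - a) : (1 + h * c) ^ k ≤ Real.exp (c * (b - a)) := by
  calc (1 + h * c) ^ k ≤ Real.exp (h * c) ^ k := by
        gcongr
        linarith [Real.add_one_le_exp (h * c)]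
    _ = Real.exp (k * (h * c)) := (Real.exp_nat_mul _ _).symm
    _ ≤ Real.exp (c * (b - a)) := by
        rw [Real.exp_le_exp, ← hn]
        have : (k : ℝ) ≤ n := by exact_mod_cast hk
        calc (k : ℝ) * (h * c) ≤ n * (h * c) := by gcongr
          _ = c * (n * h) := by ring

variable {R : ℝ≥0∞} {q r : Problem a b d} {z : ℝ → Vec d} {δ h : ℝ} {θ : ℕ → Icc a b} {n : ℕ}

lemma norm_data_le (hδ₁ : δ ≤ 1) (hq : q ∈ problemClass a b d ϱ K L R)
    (hr : r ∈ inexactData (noise₁ a b d) δ q) (t : Icc a b) (x : Vec d) :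
    ‖r.2 (t, x)‖ ≤ (K + 1) * (1 + ‖x‖) := by
  obtain ⟨-, e, ⟨-, he⟩, hr2⟩ := hr
  rw [hr2]
  refine (norm_add_le _ _).trans ((add_le_add (hq.2.2.1 t x) (he t x)).trans ?_)
  nlinarith [norm_nonneg x]

/-- One step multiplies `1 + ‖x‖` by at most `1 + h(K+1)`, as the noisy growth constant is `K + δ ≤
K + 1`; the start is at most `1 + K + δ ≤ K + 2`. -/
lemma one_add_norm_eulerPoint_le (hK : 0 < K) (hδ₁ : δ ≤ 1)
    (hq : q ∈ problemClass a b d ϱ K L R) (hr : r ∈ inexactData (noise₁ a b d) δ q) (hh : 0 ≤ h)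
    (hn : n * h = b - a) {k : ℕ} (hk : k ≤ n) :
    1 + ‖eulerPoint r h θ k‖ ≤ stateBound a b K := by
  have key : ∀ k, 1 + ‖eulerPoint r h θ k‖ ≤ (K + 2) * (1 + h * (K + 1)) ^ k := by
    intro k
    induction k with
    | zero =>
      have h1 := norm_add_le (r.1 - q.1) q.1
      rw [sub_add_cancel] at h1
      simp only [eulerPoint, pow_zero]
      linarith [hq.1, hr.1]
    | succ k ih =>
      have h1 := norm_add_le (eulerPoint r h θ k) (h • r.2 (θ k, eulerPoint r h θ k))
      rw [norm_smul, Real.norm_of_nonneg hh] at h1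
      have h2 := mul_le_mul_of_nonneg_left (norm_data_le hδ₁ hq hr (θ k) (eulerPoint r h θ k)) hh
      calc 1 + ‖eulerPoint r h θ (k + 1)‖
          ≤ (1 + ‖eulerPoint r h θ k‖) * (1 + h * (K + 1)) := by
            rw [eulerPoint]
            linarith
        _ ≤ (K + 2) * (1 + h * (K + 1)) ^ k * (1 + h * (K + 1)) := by gcongr
        _ = _ := by rw [pow_succ, mul_assoc]
  refine (key k).trans ?_
  unfold stateBound
  gcongr
  exact one_add_mul_pow_le_exp (by linarith) hh hk hn

/-- The error of the quadrature rule with one node for the velocity on the `j`-th cell. -/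
noncomputable def quadratureError (hab : a ≤ b) (q : Problem a b d) (z : ℝ → Vec d) (h : ℝ)
    (j : ℕ) (t : ℝ) : Vec d :=
  (∫ s in (a + j * h)..(a + (j + 1) * h), velocity hab q z s) - h • velocity hab q z t

/-- On each cell the increment of `z` is `h` times the velocity at the node plus the quadrature
error; the sum telescopes. -/
lemma IsSolution.sub_eulerPoint_eq (hab : a ≤ b) (hq : Continuous q.2) (hz : IsSolution q z)
    (hh : 0 ≤ h) (hn : n * h = b - a) {k : ℕ} (hk : k ≤ n) :
    z (a + k * h) - eulerPoint r h θ k = (q.1 - r.1) +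
      ∑ j ∈ Finset.range k, (quadratureError hab q z h j (θ j) +
        h • (q.2 (θ j, z (θ j)) - r.2 (θ j, eulerPoint r h θ j))) := by
  induction k with
  | zero => simp [eulerPoint, hz.1]
  | succ k ih =>
    rw [Finset.sum_range_succ, ← add_assoc, ← ih (Nat.le_of_succ_le hk), eulerPoint,
      quadratureError]
    have hk' : ((k : ℝ) + 1) * h ≤ b - a := by
      rw [← hn]
      exact mul_le_mul_of_nonneg_right (by exact_mod_cast hk) hh
    rw [hz.integral_velocity hab hq (by have := Nat.cast_nonneg (α := ℝ) k; nlinarith)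
      (by linarith) (by linarith), velocity_of_mem]
    push_cast
    module

/-- The quadrature errors stay together as one partial sum, so that their cancellation survives; all
else is estimated term by term and fed into the discrete Gronwall lemma. -/
theorem IsSolution.norm_sub_eulerPoint_le (hab : a < b) (hK : 0 < K) (hL : 0 < L)
    (hq : q ∈ problemClass a b d ϱ K L (ENNReal.ofReal (radius₀ a b K))) (hz : IsSolution q z)
    (hδ : 0 ≤ δ) (hδ₁ : δ ≤ 1) (hr : r ∈ inexactData (noise₁ a b d) δ q) (hh : 0 ≤ h)
    (hn : n * h = b - a)
    (hθ : ∀ j < n, (θ j : ℝ) ∈ Icc (a + j * h) (a + (j + 1) * h)) {k : ℕ} (hk : k ≤ n) :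
    ‖z (a + k * h) - eulerPoint r h θ k‖ ≤
      (δ + (b - a) * (L * (K * stateBound a b K * h) + δ * stateBound a b K) +
        maxPartialSum n fun j => quadratureError hab.le q z h j (θ j)) *
        Real.exp (L * (b - a)) := by
  set Q := stateBound a b K
  set M := K * Q
  have hQ : 0 < Q := stateBound_pos hK
  have hgrid : ∀ j ≤ n, a + j * h ∈ Icc a b := fun j hj => by
    have h1 : (j : ℝ) * h ≤ n * h := mul_le_mul_of_nonneg_right (by exact_mod_cast hj) hh
    exact ⟨by linarith [mul_nonneg (Nat.cast_nonneg (α := ℝ) j) hh], by linarith⟩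
  have hball : ∀ {x}, x ∈ Icc a b → edist (z x) q.1 ≤ ENNReal.ofReal (radius₀ a b K) :=
    fun hx => edist_le_radius₀ hab hK hq.1 (hz.one_add_norm_le hab hK hq hx)
  have hstep : ∀ j < n, ‖q.2 (θ j, z (θ j)) - r.2 (θ j, eulerPoint r h θ j)‖ ≤
      L * (M * h) + δ * Q + L * ‖z (a + j * h) - eulerPoint r h θ j‖ := by
    intro j hj
    obtain ⟨-, e, ⟨-, he⟩, hr2⟩ := id hr
    have hx := one_add_norm_eulerPoint_le (θ := θ) hK hδ₁ hq hr hh hn hj.le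
    have h1 := hq.2.2.2.2 (θ j) (z (θ j)) (eulerPoint r h θ j) (hball (θ j).2)
      (edist_le_radius₀ hab hK hq.1 hx)
    have h2 := (he (θ j) (eulerPoint r h θ j)).trans (mul_le_mul_of_nonneg_left hx hδ)
    have h3 := hz.norm_sub_le_mul hab hK hq (hgrid j hj.le) (θ j).2
    have h4 : |(θ j : ℝ) - (a + j * h)| ≤ h := by
      rw [abs_of_nonneg (by linarith [(hθ j hj).1])]
      linarith [(hθ j hj).2]
    have h5 := h3.trans (mul_le_mul_of_nonneg_left h4 (by positivity : 0 ≤ K * stateBound a b K))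
    have h6 := norm_sub_le_norm_sub_add_norm_sub (z (θ j)) (z (a + j * h)) (eulerPoint r h θ j)
    have h7 := mul_le_mul_of_nonneg_left (h6.trans (add_le_add_left h5 _)) hL.le
    -- The exact `f` absorbs the change of state, and the noise is evaluated at the Euler point
    -- only, so it needs no Lipschitz bound.
    rw [hr2, Pi.add_apply, ← sub_sub]
    refine (norm_sub_le _ _).trans ?_
    linarith
  set S := maxPartialSum n fun j => quadratureError hab.le q z h j (θ j)
  set B := δ + (b - a) * (L * (M * h) + δ * Q) + S
  have hS : 0 ≤ S := maxPartialSum_nonneg _ _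
  have hba : 0 < b - a := sub_pos.2 hab
  have hB : 0 ≤ B := by positivity
  have hrec : ∀ k ≤ n, ‖z (a + k * h) - eulerPoint r h θ k‖ ≤
      B + h * L * ∑ j ∈ Finset.range k, ‖z (a + j * h) - eulerPoint r h θ j‖ := by
    intro k hk
    rw [hz.sub_eulerPoint_eq hab.le hq.2.1 hh hn hk, Finset.sum_add_distrib, ← add_assoc]
    have h1 : ‖q.1 - r.1‖ ≤ δ := by rw [norm_sub_rev]; exact hr.1
    have h2 : ‖∑ j ∈ Finset.range k, quadratureError hab.le q z h j (θ j)‖ ≤ S :=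
      norm_sum_le_maxPartialSum hk _
    have h3 : ‖∑ j ∈ Finset.range k, h • (q.2 (θ j, z (θ j)) -
        r.2 (θ j, eulerPoint r h θ j))‖ ≤ (b - a) * (L * (M * h) + δ * Q) +
          h * L * ∑ j ∈ Finset.range k, ‖z (a + j * h) - eulerPoint r h θ j‖ := by
      calc _ ≤ ∑ j ∈ Finset.range k, (h * (L * (M * h) + δ * Q) +
            h * L * ‖z (a + j * h) - eulerPoint r h θ j‖) := by
            refine (norm_sum_le _ _).trans (Finset.sum_le_sum fun j hj => ?_)
            rw [norm_smul, Real.norm_of_nonneg hh]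
            have := mul_le_mul_of_nonneg_left
              (hstep j ((Finset.mem_range.1 hj).trans_le hk)) hh
            linarith
        _ = k * h * (L * (M * h) + δ * Q) +
            h * L * ∑ j ∈ Finset.range k, ‖z (a + j * h) - eulerPoint r h θ j‖ := by
            rw [Finset.sum_add_distrib, Finset.sum_const, Finset.card_range, nsmul_eq_mul,
              ← Finset.mul_sum]
            ring
        _ ≤ _ := by
            gcongr
            rw [← hn]
            have : (k : ℝ) ≤ n := by exact_mod_cast hk
            gcongr
    refine (norm_add_le _ _).trans (le_trans (add_le_add ((norm_add_le _ _).trans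
      (add_le_add h1 h2)) h3) (le_of_eq ?_))
    simp only [B]
    ring
  refine (le_mul_one_add_pow_of_le_add_sum (u := fun k => ‖z (a + k * h) - eulerPoint r h θ k‖)
    (mul_nonneg hh hL.le) hrec k hk).trans ?_
  exact mul_le_mul_of_nonneg_left (one_add_mul_pow_le_exp hL.le hh hk hn) hB

/-- The constant in the error estimate for the Euler scheme. -/
noncomputable def eulerConst (a b K L : ℝ) : ℝ :=
  K * stateBound a b K + (K + 1) * stateBound a b K +
    (1 + (b - a) * (L * (K * stateBound a b K) + stateBound a b K)) * Real.exp (L * (b - a))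

lemma eulerConst_pos (hab : a < b) (hK : 0 < K) (hL : 0 < L) : 0 < eulerConst a b K L := by
  have := stateBound_pos (a := a) (b := b) hK
  have := sub_pos.2 hab
  unfold eulerConst
  positivity

/-- Between grid points both the solution and the polygon move by at most a multiple of `h`. -/
theorem IsSolution.norm_sub_output_le {Ω : Type*} [MeasurableSpace Ω] (hab : a < b) (hK : 0 < K)
    (hL : 0 < L) (hq : q ∈ problemClass a b d ϱ K L (ENNReal.ofReal (radius₀ a b K)))
    (hz : IsSolution q z) (hδ : 0 ≤ δ) (hδ₁ : δ ≤ 1) (hr : r ∈ inexactData (noise₁ a b d) δ q)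
    (hn₀ : 0 < n) (hh : 0 ≤ h) (hhn : h = (b - a) / n) {θ : ℕ → Ω → Icc a b}
    (hθm : ∀ j, Measurable (θ j)) {ω : Ω}
    (hθ : ∀ j < n, (θ j ω : ℝ) ∈ Icc (a + j * h) (a + (j + 1) * h)) (t : Icc a b) :
    ‖z t - ((randomizedEuler hab.le hh n θ hθm).output r ω).toFun t‖ ≤
      eulerConst a b K L *
        (h + δ + maxPartialSum n fun j => quadratureError hab.le q z h j (θ j ω)) := by
  have hn' : (0 : ℝ) < n := by exact_mod_cast hn₀
  have hn : n * h = b - a := by rw [hhn]; field_simp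
  obtain ⟨k, hk, hk1, hk2⟩ := exists_cell hn₀ hab hhn t.2
  rw [output_randomizedEuler, polygon_eq r hh _ hk hk1 hk2]
  set x := eulerPoint r h (fun k => θ k ω)
  have hkI : a + k * h ∈ Icc a b :=
    ⟨by linarith [mul_nonneg (Nat.cast_nonneg (α := ℝ) k) hh], hk1.trans t.2.2⟩
  have hQ : 0 < stateBound a b K := stateBound_pos hK
  have hba : 0 < b - a := sub_pos.2 hab
  have h1 := hz.norm_sub_eulerPoint_le (θ := fun k => θ k ω) hab hK hL hq hδ hδ₁ hr hh hn hθ hk.le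
  have h2 := hz.norm_sub_le_mul hab hK hq hkI t.2
  have habs : |(t : ℝ) - (a + k * h)| ≤ h := by
    rw [abs_of_nonneg (by linarith)]
    linarith
  have h2' := h2.trans (mul_le_mul_of_nonneg_left habs (by positivity))
  have h3 : ‖((t : ℝ) - (a + k * h)) • r.2 (θ k ω, x k)‖ ≤
      h * ((K + 1) * stateBound a b K) := by
    rw [norm_smul, Real.norm_eq_abs]
    refine mul_le_mul habs ((norm_data_le hδ₁ hq hr _ _).trans ?_) (norm_nonneg _) hh
    exact mul_le_mul_of_nonneg_left (one_add_norm_eulerPoint_le hK hδ₁ hq hr hh hn hk.le)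
      (by linarith)
  set S := maxPartialSum n fun j => quadratureError hab.le q z h j (θ j ω)
  have hS : 0 ≤ S := maxPartialSum_nonneg _ _
  have h4 : z t - (x k + ((t : ℝ) - (a + k * h)) • r.2 (θ k ω, x k)) =
      (z t - z (a + k * h)) + (z (a + k * h) - x k) -
        ((t : ℝ) - (a + k * h)) • r.2 (θ k ω, x k) := by abel
  rw [h4]
  refine (norm_sub_le _ _).trans ((add_le_add ((norm_add_le _ _).trans (add_le_add h2' h1))
    h3).trans ?_)
  unfold eulerConst
  set Q := stateBound a b K
  set E := Real.exp (L * (b - a))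
  have hE : 0 < E := Real.exp_pos _
  -- `p1`, `p2`, `p3` add up to the excess of the single constant times `h + δ + S` over the bound
  -- obtained.
  have p1 : 0 ≤ K * Q * (δ + S) := by positivity
  have p2 : 0 ≤ (K + 1) * Q * (δ + S) := by positivity
  have p3 : 0 ≤ (h + (b - a) * (L * (K * Q)) * (δ + S) + (b - a) * Q * (h + S)) * E := by
    positivity
  linarith

end ErrorBound

/-! ### The random quadrature errors -/

section Quadrature

variable {a b : ℝ} {d : ℕ} {ϱ K L h : ℝ} {q : Problem a b d} {z : ℝ → Vec d} {n j : ℕ}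

/-- The point of the `j`-th cell with relative position `y`. -/
noncomputable def cellTime (hab : a ≤ b) (h : ℝ) (j : ℕ) (y : ℝ) : Icc a b :=
  projIcc a b hab (a + (j + max 0 (min 1 y)) * h)

lemma continuous_cellTime (hab : a ≤ b) (h : ℝ) (j : ℕ) : Continuous (cellTime hab h j) :=
  continuous_projIcc.comp (by fun_prop)

lemma cell_subset (hh : 0 ≤ h) (hn : n * h = b - a) (hj : j < n) :
    Icc (a + j * h) (a + (j + 1) * h) ⊆ Icc a b := by
  have h1 : ((j : ℝ) + 1) * h ≤ n * h := mul_le_mul_of_nonneg_right (by exact_mod_cast hj) hh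
  exact Icc_subset_Icc (by linarith [mul_nonneg (Nat.cast_nonneg (α := ℝ) j) hh]) (by linarith)

lemma add_clamp_mul_mem_cell (hh : 0 ≤ h) (y : ℝ) :
    a + (j + max 0 (min 1 y)) * h ∈ Icc (a + j * h) (a + (j + 1) * h) := by
  have h0 : 0 ≤ max 0 (min 1 y) := le_max_left _ _
  have h1 : max 0 (min 1 y) ≤ 1 := max_le zero_le_one (min_le_left _ _)
  constructor
  · linarith [mul_nonneg h0 hh]
  · linarith [mul_le_mul_of_nonneg_right h1 hh]

lemma coe_cellTime (hab : a ≤ b) (hh : 0 ≤ h) (hn : n * h = b - a) (hj : j < n) (y : ℝ) :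
    (cellTime hab h j y : ℝ) = a + (j + max 0 (min 1 y)) * h := by
  rw [cellTime, projIcc_of_mem hab (cell_subset hh hn hj (add_clamp_mul_mem_cell hh y))]

/-- Owing to the clamp this holds for every real `y`. The uniform variables lie in `(0,1)` only
almost surely, whereas the path estimates are used for every `ω`. -/
lemma cellTime_mem_cell (hab : a ≤ b) (hh : 0 ≤ h) (hn : n * h = b - a) (hj : j < n) (y : ℝ) :
    (cellTime hab h j y : ℝ) ∈ Icc (a + j * h) (a + (j + 1) * h) := by
  rw [coe_cellTime hab hh hn hj]
  exact add_clamp_mul_mem_cell hh y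

lemma IsSolution.continuous_quadratureError (hab : a ≤ b) (hq : Continuous q.2)
    (hz : IsSolution q z) (h : ℝ) (j : ℕ) : Continuous (quadratureError hab q z h j) :=
  continuous_const.sub ((continuous_velocity hab hq hz.continuousOn).const_smul h)

/-- The error is the integral over the cell of the oscillation of the velocity about its value at
`s`. -/
lemma IsSolution.norm_quadratureError_le (hab : a < b) (hK : 0 < K) (hL : 0 < L) (hϱ : 0 ≤ ϱ)
    (hq : q ∈ problemClass a b d ϱ K L (ENNReal.ofReal (radius₀ a b K))) (hz : IsSolution q z)
    (hh : 0 ≤ h) (hn : n * h = b - a) (hj : j < n) {s : ℝ}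
    (hs : s ∈ Icc (a + j * h) (a + (j + 1) * h)) :
    ‖quadratureError hab.le q z h j s‖ ≤ (L * h ^ ϱ + L * (K * stateBound a b K * h)) * h := by
  have hg := continuous_velocity hab.le hq.2.1 hz.continuousOn
  have hlen : a + ((j : ℝ) + 1) * h - (a + j * h) = h := by ring
  have hQ := stateBound_pos (a := a) (b := b) hK
  have h1 : quadratureError hab.le q z h j s = ∫ x in (a + j * h)..(a + (j + 1) * h),
      (velocity hab.le q z x - velocity hab.le q z s) := by
    rw [intervalIntegral.integral_sub (hg.intervalIntegrable _ _) (by simp),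
      intervalIntegral.integral_const, hlen]
    rfl
  rw [h1]
  refine (intervalIntegral.norm_integral_le_of_norm_le_const
    (C := L * h ^ ϱ + L * (K * stateBound a b K * h)) fun x hx => ?_).trans (le_of_eq ?_)
  · rw [uIoc_of_le (by linarith)] at hx
    have hx' := Ioc_subset_Icc_self hx
    refine (hz.norm_velocity_sub_le hab hK hL hq (cell_subset hh hn hj hs)
      (cell_subset hh hn hj hx')).trans ?_
    have habs : |x - s| ≤ h := abs_le.2 ⟨by linarith [hx'.1, hs.2], by linarith [hx'.2, hs.1]⟩
    gcongr
  · rw [hlen, abs_of_nonneg hh]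

/-- A uniform node makes the rule unbiased: the mean of `h` times the velocity is its integral over
the cell, by an affine substitution. -/
lemma IsSolution.integral_quadratureError {Ω : Type*} [MeasurableSpace Ω] {P : Measure Ω}
    (hab : a ≤ b) (hq : Continuous q.2) (hz : IsSolution q z) (hh : 0 < h) (hn : n * h = b - a)
    (hj : j < n) {τ : Ω → ℝ} (hτ : Measurable τ)
    (hu : P.map τ = volume.restrict (Ioo 0 1)) :
    ∫ ω, quadratureError hab q z h j (cellTime hab h j (τ ω)) ∂P = 0 := by
  have hg := continuous_velocity hab hq hz.continuousOn
  have hc : Continuous fun y => quadratureError hab q z h j (cellTime hab h j y) :=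
    (hz.continuous_quadratureError hab hq h j).comp
      (continuous_subtype_val.comp (continuous_cellTime hab h j))
  have h1 : ∫ ω, quadratureError hab q z h j (cellTime hab h j (τ ω)) ∂P =
      ∫ y in Ioo 0 1, quadratureError hab q z h j (cellTime hab h j y) := by
    rw [← hu, integral_map hτ.aemeasurable hc.aestronglyMeasurable]
  have h2 : ∫ y in Ioo 0 1, quadratureError hab q z h j (cellTime hab h j y) =
      ∫ y in Ioo (0 : ℝ) 1, quadratureError hab q z h j (a + j * h + h * y) := by
    refine setIntegral_congr_fun measurableSet_Ioo fun y hy => ?_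
    rw [coe_cellTime hab hh.le hn hj, min_eq_right hy.2.le, max_eq_right hy.1.le]
    congr 1
    ring
  have hc' : Continuous fun y => h • velocity hab q z (a + j * h + h * y) :=
    (hg.comp (by fun_prop)).const_smul h
  rw [h1, h2, ← integral_Ioc_eq_integral_Ioo, ← intervalIntegral.integral_of_le zero_le_one]
  simp only [quadratureError]
  rw [intervalIntegral.integral_sub (by simp) (hc'.intervalIntegrable _ _),
    intervalIntegral.integral_const, intervalIntegral.integral_smul,
    intervalIntegral.integral_comp_add_mul _ hh.ne', smul_smul, mul_inv_cancel₀ hh.ne', one_smul,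
    sub_zero, one_smul, sub_eq_zero]
  congr 1 <;> ring

lemma maxPartialSum_congr {E : Type*} [SeminormedAddCommGroup E] {D D' : ℕ → E}
    (hD : ∀ j < n, D j = D' j) : maxPartialSum n D = maxPartialSum n D' := by
  refine Finset.sup'_congr _ rfl fun k hk => ?_
  congr 1
  exact Finset.sum_congr rfl fun j hj =>
    hD j ((Finset.mem_range.1 hj).trans_le (Finset.mem_range_succ_iff.1 hk))

end Quadrature

/-! ### The upper bound for the minimal error. -/

section UpperBound

variable {a b : ℝ} {d : ℕ} {ϱ K L : ℝ}

theorem exists_minimalError_le_ofReal_sqrt (hab : a < b) (hd : 1 ≤ d) (hK : 0 < K) (hL : 0 < L)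
    (hϱ₀ : 0 < ϱ) {p : ℝ} (hp : 1 ≤ p) :
    ∃ A > (0 : ℝ), ∀ (Ω : Type*) [MeasurableSpace Ω] (P : Measure Ω) [IsProbabilityMeasure P],
      CarriesUniforms P → ∀ n N : ℕ, 0 < N → 2 * N ≤ n → ∀ δ : ℝ, 0 ≤ δ → δ ≤ 1 → ∀ h : ℝ,
      h = (b - a) / N →
      minimalError P p n (problemClass a b d ϱ K L (ENNReal.ofReal (radius₀ a b K)))
        (noise₁ a b d) δ ≤
      ENNReal.ofReal (eulerConst a b K L *
        (h + δ + A * ((L * h ^ ϱ + L * (K * stateBound a b K * h)) * h * √N))) := by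
  obtain ⟨A, hA, hmax⟩ := exists_lintegral_maxPartialSum_le hd (by linarith : 0 < p)
  refine ⟨A, hA, fun Ω _ P _ hP n N hN hNn δ hδ hδ₁ h hhN => ?_⟩
  have hba : 0 < b - a := sub_pos.2 hab
  have hN' : (0 : ℝ) < N := by exact_mod_cast hN
  have hh : 0 < h := by rw [hhN]; positivity
  have hNh : N * h = b - a := by rw [hhN]; field_simp
  have hQ := stateBound_pos (a := a) (b := b) hK
  have hC := eulerConst_pos hab hK hL
  obtain ⟨τ, hτm, hτu, hτi⟩ := exists_uniform_sequence hP N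
  set θ : ℕ → Ω → Icc a b := fun j ω => cellTime hab.le h j (τ j ω)
  have hθm : ∀ j, Measurable (θ j) := fun j =>
    (continuous_cellTime hab.le h j).measurable.comp (hτm j)
  set c := (L * h ^ ϱ + L * (K * stateBound a b K * h)) * h
  have hc : 0 < c := by positivity
  refine iInf₂_le_of_le (randomizedEuler hab.le hh.le N θ hθm) hNn ?_
  refine iSup₂_le fun q hq => iSup₂_le fun r hr => ?_
  have hz := isSolution_solution hab hK hL hq
  set z := solution q
  -- The maximal inequality requires a centred bounded sequence over all of `ℕ`; past `N` the
  -- variables are padding, so the terms are set to zero.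
  set G : ℕ → ℝ → Vec d := fun j y =>
    if j < N then quadratureError hab.le q z h j (cellTime hab.le h j y) else 0
  have hGm : ∀ j, Measurable (G j) := fun j => by
    by_cases hj : j < N
    · simp only [G, hj, if_true]
      exact ((hz.continuous_quadratureError hab.le hq.2.1 h j).comp
        (continuous_subtype_val.comp (continuous_cellTime hab.le h j))).measurable
    · simp only [G, hj, if_false]
      exact measurable_const
  have hGnorm : ∀ j y, ‖G j y‖ ≤ c := fun j y => by
    by_cases hj : j < N
    · simp only [G, hj, if_true]
      exact hz.norm_quadratureError_le hab hK hL hϱ₀.le hq hh.le hNh hj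
        (cellTime_mem_cell hab.le hh.le hNh hj y)
    · simp only [G, hj, if_false, norm_zero]
      exact hc.le
  have hG0 : ∀ j, ∫ ω, G j (τ j ω) ∂P = 0 := fun j => by
    by_cases hj : j < N
    · simp only [G, hj, if_true]
      exact hz.integral_quadratureError hab.le hq.2.1 hh hNh hj (hτm j) (hτu j hj)
    · simp only [G, hj, if_false, integral_zero]
  have hG0' : ∀ j i, ∫ ω, G j (τ j ω) i ∂P = 0 := fun j i => by
    have hint : Integrable (fun ω => G j (τ j ω)) P :=
      Integrable.of_bound ((hGm j).comp (hτm j)).aestronglyMeasurable c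
        (ae_of_all _ fun ω => hGnorm j _)
    have h := (PiLp.proj (𝕜 := ℝ) 1 (fun _ : Fin d => ℝ) i).integral_comp_comm hint
    rw [hG0 j, map_zero] at h
    exact h
  have hmom := hmax Ω P (fun j ω => G j (τ j ω)) c N (fun j => (hGm j).comp (hτm j))
    (hτi.comp G hGm) hc
    (fun j ω i => (PiLp.norm_apply_le (G j (τ j ω)) i).trans (hGnorm j _)) hG0' hN
  set S : Ω → ℝ := fun ω => maxPartialSum N fun j => G j (τ j ω)
  have hSm : Measurable S := measurable_maxPartialSum (fun j => (hGm j).comp (hτm j)) N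
  have hS : ∀ ω, S ω =
      maxPartialSum N fun j => quadratureError hab.le q z h j (θ j ω) := fun ω =>
    maxPartialSum_congr fun j hj => by simp only [G, hj, if_true, θ]
  set E := eulerConst a b K L
  have hpt : ∀ ω, (⨆ t : Icc a b,
      ‖z t - ((randomizedEuler hab.le hh.le N θ hθm).output r ω).toFun t‖ₑ) ≤
        ENNReal.ofReal (E * (h + δ)) + ENNReal.ofReal E * ENNReal.ofReal (S ω) := fun ω => by
    refine iSup_le fun t => ?_
    have hS₀ : 0 ≤ S ω := maxPartialSum_nonneg _ _
    rw [← ENNReal.ofReal_mul hC.le, ← ENNReal.ofReal_add (by positivity)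
      (mul_nonneg hC.le hS₀), ← mul_add, ← ofReal_norm, hS ω]
    exact ENNReal.ofReal_le_ofReal (hz.norm_sub_output_le hab hK hL hq hδ hδ₁ hr hN hh.le hhN
      hθm (fun j hj => cellTime_mem_cell hab.le hh.le hNh hj _) t)
  have hp₀ : 0 < p := by linarith
  calc (∫⁻ ω, (⨆ t : Icc a b,
        ‖z t - ((randomizedEuler hab.le hh.le N θ hθm).output r ω).toFun t‖ₑ) ^ p ∂P) ^ (1 / p)
      ≤ (∫⁻ ω, ((fun _ : Ω => ENNReal.ofReal (E * (h + δ))) +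
          fun ω : Ω => ENNReal.ofReal E * ENNReal.ofReal (S ω)) ω ^ p ∂P) ^ (1 / p) := by
        gcongr with ω
        exact hpt ω
    _ ≤ (∫⁻ _, ENNReal.ofReal (E * (h + δ)) ^ p ∂P) ^ (1 / p) +
          (∫⁻ ω, (ENNReal.ofReal E * ENNReal.ofReal (S ω)) ^ p ∂P) ^ (1 / p) :=
        ENNReal.lintegral_Lp_add_le aemeasurable_const
          (hSm.ennreal_ofReal.const_mul _).aemeasurable hp
    _ = ENNReal.ofReal (E * (h + δ)) +
          ENNReal.ofReal E * (∫⁻ ω, ENNReal.ofReal (S ω) ^ p ∂P) ^ (1 / p) := by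
        simp_rw [ENNReal.mul_rpow_of_nonneg _ _ hp₀.le]
        rw [lintegral_const, measure_univ, mul_one, lintegral_const_mul _
          (hSm.ennreal_ofReal.pow_const _), ENNReal.mul_rpow_of_nonneg _ _ (by positivity),
          ← ENNReal.rpow_mul, ← ENNReal.rpow_mul, mul_one_div_cancel hp₀.ne', ENNReal.rpow_one,
          ENNReal.rpow_one]
    _ ≤ ENNReal.ofReal (E * (h + δ)) + ENNReal.ofReal E * ENNReal.ofReal (A * (c * √N)) := by
        gcongr
    _ = _ := by
        rw [← ENNReal.ofReal_mul hC.le, ← ENNReal.ofReal_add (by positivity) (by positivity)]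
        congr 1
        ring

theorem exists_minimalError_le (hab : a < b) (hd : 1 ≤ d) (hK : 0 < K) (hL : 0 < L)
    (hϱ₀ : 0 < ϱ) {p : ℝ} (hp : 1 ≤ p) :
    ∃ C > (0 : ℝ), ∀ (Ω : Type*) [MeasurableSpace Ω] (P : Measure Ω) [IsProbabilityMeasure P],
      CarriesUniforms P → ∀ n : ℕ, 2 ≤ n → ∀ δ : ℝ, 0 ≤ δ → δ ≤ 1 →
      minimalError P p n (problemClass a b d ϱ K L (ENNReal.ofReal (radius₀ a b K)))
        (noise₁ a b d) δ ≤ ENNReal.ofReal (C * ((n : ℝ) ^ (-min 1 (ϱ + 1 / 2)) + δ)) := by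
  obtain ⟨A, hA, hbound⟩ := exists_minimalError_le_ofReal_sqrt hab hd hK hL hϱ₀ hp
  have hba : 0 < b - a := sub_pos.2 hab
  have hQ := stateBound_pos (a := a) (b := b) hK
  have hE := eulerConst_pos hab hK hL
  set M := K * stateBound a b K
  set E := eulerConst a b K L
  set H := L * (b - a) ^ ϱ * (b - a) + L * (M * (b - a)) * (b - a)
  have hH : 0 < H := by positivity
  refine ⟨E * (1 + 4 * ((b - a) + A * H)), by positivity, fun Ω _ P _ hP n hn δ hδ hδ₁ => ?_⟩
  -- Each cell costs two evaluations. For `n ≥ 2` this gives `n ≤ 4N`, so passing from `N` to `n`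
  -- costs at most a factor 4.
  set N := n / 2
  have hN : 0 < N := Nat.div_pos hn two_pos
  have hN' : (0 : ℝ) < N := by exact_mod_cast hN
  have hN1 : (1 : ℝ) ≤ N := by exact_mod_cast hN
  have hn' : (0 : ℝ) < n := by exact_mod_cast (by omega : 0 < n)
  have hnN : (n : ℝ) ≤ 4 * N := by exact_mod_cast (by omega : n ≤ 4 * N)
  refine (hbound Ω P hP n N hN (Nat.mul_div_le n 2) δ hδ hδ₁ _ rfl).trans
    (ENNReal.ofReal_le_ofReal ?_)
  set m := min 1 (ϱ + 1 / 2)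
  have hm₀ : 0 < m := lt_min one_pos (by linarith)
  have hm₁ : m ≤ 1 := min_le_left _ _
  have hpow : (N : ℝ) ^ (-m) ≤ 4 * (n : ℝ) ^ (-m) := by
    have h4 : (0 : ℝ) < 4 := by norm_num
    rw [Real.rpow_neg hN'.le, Real.rpow_neg hn'.le, ← div_eq_mul_inv,
      inv_le_comm₀ (by positivity) (by positivity), inv_div, div_le_iff₀ h4]
    calc (n : ℝ) ^ m ≤ (4 * N) ^ m := Real.rpow_le_rpow hn'.le hnN hm₀.le
      _ = 4 ^ m * (N : ℝ) ^ m := Real.mul_rpow h4.le hN'.le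
      _ ≤ 4 * (N : ℝ) ^ m := by
        gcongr
        calc (4 : ℝ) ^ m ≤ 4 ^ (1 : ℝ) :=
              Real.rpow_le_rpow_of_exponent_le (by norm_num) hm₁
          _ = 4 := Real.rpow_one _
      _ = _ := mul_comm _ _
  have hh : (b - a) / N ≤ (b - a) * (N : ℝ) ^ (-m) := by
    rw [div_eq_mul_inv, ← Real.rpow_neg_one]
    gcongr
  have hsqrt : √(N : ℝ) = (N : ℝ) ^ (1 / 2 : ℝ) := Real.sqrt_eq_rpow _
  have hD1 : ((b - a) / N) ^ ϱ * ((b - a) / N) * √N ≤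
      (b - a) ^ ϱ * (b - a) * (N : ℝ) ^ (-m) := by
    have : ((b - a) / N) ^ ϱ * ((b - a) / N) * √N =
        (b - a) ^ ϱ * (b - a) * (N : ℝ) ^ (-(ϱ + 1 / 2)) := by
      rw [Real.div_rpow hba.le hN'.le, hsqrt, show -(ϱ + 1 / 2) = -ϱ + (-1 + 1 / 2) by ring,
        Real.rpow_add hN', Real.rpow_add hN', Real.rpow_neg hN'.le, Real.rpow_neg_one]
      field_simp
    rw [this]
    gcongr
    exact min_le_right _ _
  -- The Lipschitz part of the quadrature error is `h²√N`, which `√N ≤ N` reduces to order `h`.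
  have hD2 : (b - a) / N * ((b - a) / N) * √N ≤ (b - a) * (b - a) * (N : ℝ) ^ (-m) := by
    have h1 : √(N : ℝ) ≤ N := by
      rw [Real.sqrt_le_left hN'.le]
      nlinarith
    calc (b - a) / N * ((b - a) / N) * √N ≤ (b - a) / N * ((b - a) / N) * N := by gcongr
      _ = (b - a) * ((b - a) / N) := by field_simp
      _ ≤ (b - a) * ((b - a) * (N : ℝ) ^ (-m)) := by gcongr
      _ = _ := by ring
  have hsum : (L * ((b - a) / N) ^ ϱ + L * (M * ((b - a) / N))) * ((b - a) / N) * √N ≤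
      H * (N : ℝ) ^ (-m) := by
    have h1 := mul_le_mul_of_nonneg_left hD1 hL.le
    have h2 := mul_le_mul_of_nonneg_left hD2 (by positivity : 0 ≤ L * M)
    simp only [H]
    linarith
  calc E * ((b - a) / N + δ +
        A * ((L * ((b - a) / N) ^ ϱ + L * (M * ((b - a) / N))) * ((b - a) / N) * √N))
      ≤ E * ((b - a) * (4 * (n : ℝ) ^ (-m)) + δ + A * (H * (4 * (n : ℝ) ^ (-m)))) := by
        have h1 := hh.trans (mul_le_mul_of_nonneg_left hpow hba.le)
        have h2 := hsum.trans (mul_le_mul_of_nonneg_left hpow hH.le)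
        exact mul_le_mul_of_nonneg_left (add_le_add (add_le_add_left h1 δ)
          (mul_le_mul_of_nonneg_left h2 hA.le)) hE.le
    _ ≤ _ := by
        have hx : 0 ≤ (n : ℝ) ^ (-m) := by positivity
        have : 0 ≤ E * ((n : ℝ) ^ (-m) + 4 * ((b - a) + A * H) * δ) := by positivity
        linarith

end UpperBound

end InexactODE

/-! ### The two-sided estimate. -/

theorem theorem5p1 (a b : ℝ) (hab : a < b) (d : ℕ) (hd : 1 ≤ d) (K L : ℝ) (hK : 0 < K)
    (hL : 0 < L) (p : ℝ) (hp : 2 ≤ p) (ϱ : ℝ) (hϱ₀ : 0 < ϱ) (hϱ₁ : ϱ ≤ 1) :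
    ∃ C₁ > (0 : ℝ), ∃ C₂ > (0 : ℝ), ∃ n₀ : ℕ, ∃ δ₀ ∈ Ioc (0 : ℝ) 1,
      ∀ (Ω : Type*) [MeasurableSpace Ω] (P : Measure Ω) [IsProbabilityMeasure P],
        CarriesUniforms P →
        ∀ n : ℕ, n₀ ≤ n → ∀ δ : ℝ, 0 ≤ δ → δ ≤ δ₀ →
          ENNReal.ofReal (C₁ * ((n : ℝ) ^ (-(ϱ + 1 / 2)) + δ)) ≤
              minimalError P p n (problemClass a b d ϱ K L ⊤) (noise₂ a b d) δ ∧
          minimalError P p n (problemClass a b d ϱ K L ⊤) (noise₂ a b d) δ ≤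
              minimalError P p n (problemClass a b d ϱ K L (ENNReal.ofReal (radius₀ a b K)))
                (noise₁ a b d) δ ∧
          minimalError P p n (problemClass a b d ϱ K L (ENNReal.ofReal (radius₀ a b K)))
                (noise₁ a b d) δ ≤
              ENNReal.ofReal (C₂ * ((n : ℝ) ^ (-min 1 (ϱ + 1 / 2)) + δ)) := by
  obtain ⟨C, hC, hlow⟩ := exists_ofReal_rpow_le_minimalError hab hd hK hL hϱ₀.le hϱ₁ hp
  obtain ⟨C₂, hC₂, hup⟩ :=
    exists_minimalError_le hab hd hK hL hϱ₀ (one_le_two.trans hp)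
  -- The half turns the maximum of the two lower bounds into their sum. `n ≥ 2` provides at least
  -- one cell, and `δ ≤ K` is needed for the noise lower bound.
  refine ⟨min C 1 / 2, by positivity, C₂, hC₂, 2, min 1 K, ⟨lt_min one_pos hK, min_le_left _ _⟩,
    fun Ω _ P _ hP n hn δ hδ hδ₀ => ⟨?_, ?_, ?_⟩⟩
  · have h1 := hlow Ω P n (by omega) δ hδ
    have h2 := ofReal_noise_le_minimalError (ϱ := ϱ) hab hd hK hL hp (P := P) n hδ
      (hδ₀.trans (min_le_right _ _))
    refine le_trans ?_ (max_le h1 h2)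
    rw [← ENNReal.ofReal_max]
    refine ENNReal.ofReal_le_ofReal ?_
    have hx : 0 ≤ (n : ℝ) ^ (-(ϱ + 1 / 2)) := by positivity
    have h3 := mul_le_mul_of_nonneg_right (min_le_left C 1) hx
    have h4 := mul_le_mul_of_nonneg_right (min_le_right C 1) hδ
    have h5 := le_max_left (C * (n : ℝ) ^ (-(ϱ + 1 / 2))) δ
    have h6 := le_max_right (C * (n : ℝ) ^ (-(ϱ + 1 / 2))) δ
    linarith
  · exact minimalError_mono P p n (problemClass_anti le_top) fun e he => he.1
  · exact hup Ω P hP n hn δ hδ (hδ₀.trans (min_le_left _ _))
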